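/- There is a universal constant $C$ such that the following holds. Let $\mathcal X$ be a countable set, $\mathcal H\subseteq\{-1,1\}^{\mathcal X}$ a countable hypothesis class of VC-dimension $d<\infty$, $\mathrm{ERM}$ an empirical risk minimizer for $\mathcal H$ (a map from finite training sequences to functions $\mathcal X\to\{-1,1\}$ that returns, for every training sequence realizable by $\mathcal H$, a member of $\mathcal H$ consistent with it), $\mathcal D$ a probability distribution on $\mathcal X$, $c\in\mathcal H$ a target concept, $0<\delta<1$, $m=6^k$ with an integer $k\ge 1$, $T$ a finite (possibly empty) training sequence realizable by $c$ (i.e. $c(x)=y$ for all $(x,y)\in T$), and $r=(r_1,\dots,r_n)$ a finite string of finite strings of numbers in $[0,1]$. Let $\mathcal D_c$ be the distribution of $(\mathbf x,c(\mathbf x))$ for $\mathbf x\sim\mathcal D$. Then with probability at least $1-\delta$ over $\mathbf S\sim\mathcal D_c^m$, $$\mathbb P_{\mathbf x\sim\mathcal D}\Bigg[\frac1{|\mathcal S(\mathbf S,T)|}\sum_{f\in\mathcal A(\mathcal S(\mathbf S,T),r)}\mathbb 1\Big\{\frac1t\sum_{i=1}^t\mathbb 1\{h_{f,i}(\mathbf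 x)=c(\mathbf x)\}\ge\tfrac34\Big\}<\tfrac34\Bigg]\le C\,\frac{d+\ln(1/\delta)}{m}.$$ Here $\mathcal S$ and $\mathcal A$ are the following algorithms, and $\mathcal A(\mathcal S(S,T),r)=[\mathcal A(S',r)]_{S'\in\mathcal S(S,T)}$, where each $f=\mathcal A(S',r)$ is a majority vote with voters $h_{f,1},\dots,h_{f,t}$; sequences are taken with multiplicity and $\sqcup$ denotes concatenation. *Subsampling $\mathcal S(S,T)$.* If $|S|\ge 6$, split $S$ into consecutive blocks $S_0,\dots,S_5$ of length $|S|/6$ and return the concatenation of the lists $\mathcal S(S_0,S_i\sqcup T)$, $i=1,\dots,5$. Otherwise return the one-element list $[S\sqcup T]$. *Boosting $\mathcal A(S,r)$*, for $S=((x_1,y_1),\dots,(x_M,y_M))$. Put $t=\lceil 20^2\ln(M)/2\rceil$, $\gamma=9/20$, $\theta=3/4$, $\alpha=\frac12\ln\frac{1+2\gamma}{1-2\gamma}-\frac12\ln\frac{1+\theta}{1-\theta}$, and let $D_1$ be uniform on $\{1,\dots,M\}$. For $i=1,\dots,n$: let $C_i$ be the cumulative distribution function of $D_i$; form the training sequence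 $S_i$ by replacing each entry $u$ of $r_i$ by the example of $S$ whose index $l$ satisfies $C_i(l-1)\le u<C_i(l)$ (the last example of $S$ if $u=1$); let $h_i=\mathrm{ERM}(S_i)$ and $\epsilon_i=\sum_j D_i(j)\mathbb 1\{h_i(x_j)\ne y_j\}$; call round $i$ successful if $\epsilon_i\le\frac12-\gamma$, and set $\alpha_i=\alpha$ if it is successful and $\alpha_i=0$ otherwise; let $D_{i+1}(j)=D_i(j)\exp(-\alpha_ih_i(x_j)y_j)/Z_i$ with $Z_i$ normalizing $D_{i+1}$ to a probability distribution. If there are at least $t$ successful rounds and the vote $f=\frac1t\sum_{j=1}^t h_{f,j}$ of the hypotheses of the first $t$ successful rounds satisfies $\frac1M\,|\{j: y_jf(x_j)\le\theta\}|<\frac1M$, return $f$. Otherwise return $\mathrm{ERM}(S)$, regarded as the vote of $t$ copies of itself. -/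

import Mathlib

open MeasureTheory
open scoped BigOperators

noncomputable section

namespace OptPAC

/-- The labels `{-1, 1}`. -/
abbrev Label : Type := ℤˣ

/-- The real number `-1` or `1` that a label stands for. -/
def Label.toReal (y : Label) : ℝ := ((y : ℤ) : ℝ)

/-- Every set of labels is measurable. -/
instance : DiscreteMeasurableSpace Label where
  forall_measurableSet s :=
    ⟨((↑) : Label → ℤ) '' s, trivial, Set.preimage_image_eq s Units.val_injective⟩

/-- Functions `X → {-1, 1}`. -/
abbrev Hyp (X : Type*) : Type _ := X → Label

/-- Finite training sequences, repetitions allowed. -/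
abbrev TrainSeq (X : Type*) : Type _ := List (X × Label)

variable {X : Type*}

/-- `S` is realizable by the function `c`. -/
def RealizableBy (c : Hyp X) (S : TrainSeq X) : Prop := ∀ z ∈ S, c z.1 = z.2

/-- `erm` is an empirical risk minimizer for `H`: on every training sequence realizable by `H` it
returns a member of `H` that is consistent with the sequence. -/
def IsERM (H : Set (Hyp X)) (erm : TrainSeq X → Hyp X) : Prop :=
  ∀ S : TrainSeq X, (∃ h ∈ H, RealizableBy h S) → erm S ∈ H ∧ RealizableBy (erm S) S

/-- `H` has VC-dimension `d`: `d` is the largest number of points on which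
every sign pattern is realized by a member of `H`. -/
def HasVCDim (H : Set (Hyp X)) (d : ℕ) : Prop :=
  IsGreatest {n : ℕ | ∃ x : Fin n → X, ∀ y : Fin n → Label, ∃ h ∈ H, ∀ i, h (x i) = y i} d

/-- The distribution of `(x, c x)` for `x ∼ D`. -/
def labeled [MeasurableSpace X] (D : Measure X) (c : Hyp X) : Measure (X × Label) :=
  D.map (fun x => (x, c x))

/-! ### The subsampling algorithm -/

/-- The `i`-th of the six consecutive blocks of `S`: the examples number
`i|S|/6 + 1` to `(i+1)|S|/6`. -/
def block {α : Type*} (S : List α) (i : ℕ) : List α :=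
  (S.take ((i + 1) * S.length / 6)).drop (i * S.length / 6)

theorem length_block_zero_lt {α : Type*} (S : List α) (h : 6 ≤ S.length) :
    (block S 0).length < S.length := by
  simp only [block, List.length_drop, List.length_take]
  omega

/-- The subsampling algorithm: the list of the sub training sequences produced from `S` and `T`. -/
def subsample {α : Type*} (S T : List α) : List (List α) :=
  if _h : 6 ≤ S.length then
    subsample (block S 0) (block S 1 ++ T) ++
    subsample (block S 0) (block S 2 ++ T) ++
    subsample (block S 0) (block S 3 ++ T) ++
    subsample (block S 0) (block S 4 ++ T) ++
    subsample (block S 0) (block S 5 ++ T)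
  else [S ++ T]
termination_by S.length
decreasing_by all_goals exact length_block_zero_lt S _h

/-! ### The boosting algorithm -/

/-- The number `⌈20² ln(m) / 2⌉` of voters. -/
def numVoters (m : ℕ) : ℕ := ⌈(20 : ℝ) ^ 2 * Real.log m / 2⌉₊

/-- The constant learning rate, for `γ = 9/20` and `θ = 3/4`. -/
def stepSize : ℝ :=
  1 / 2 * Real.log ((1 + 2 * (9 / 20)) / (1 - 2 * (9 / 20)))
    - 1 / 2 * Real.log ((1 + 3 / 4) / (1 - 3 / 4))

open Classical in
/-- The example of `S` whose index `l` satisfies `C(l-1) ≤ u < C(l)`, where `C` is the cumulative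
distribution function of `D`. If there is no such index (for `u = 1`), the last example.
The value is `none` only if `S` is empty. -/
def invCDF (S : TrainSeq X) (D : Fin S.length → ℝ) (u : ℝ) : Option (X × Label) :=
  if h : ∃ l : Fin S.length, ∑ j ∈ Finset.Iio l, D j ≤ u ∧ u < ∑ j ∈ Finset.Iic l, D j then
    some (S.get h.choose)
  else S.getLast?

/-- The training sequence drawn from `S` according to `D` by means of the numbers in `u`. -/
def resample (S : TrainSeq X) (D : Fin S.length → ℝ) (u : List unitInterval) : TrainSeq X :=
  u.filterMap (fun v => invCDF S D (v : ℝ))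

/-- The `D`-weighted error of `h` on `S`. -/
def loss (S : TrainSeq X) (D : Fin S.length → ℝ) (h : Hyp X) : ℝ :=
  ∑ j, if h (S.get j).1 ≠ (S.get j).2 then D j else 0

/-- The exponential update of the weights, with normalization. -/
def reweight (S : TrainSeq X) (D : Fin S.length → ℝ) (α : ℝ) (h : Hyp X) :
    Fin S.length → ℝ := fun j =>
  D j * Real.exp (-α * (h (S.get j).1).toReal * (S.get j).2.toReal) /
    ∑ i, D i * Real.exp (-α * (h (S.get i).1).toReal * (S.get i).2.toReal)

open Classical in
/-- The boosting rounds from the weights `D` on, one for each entry of the string.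
The value is the list of the hypotheses of the successful rounds (those with weighted error
at most `1/2 - γ = 1/2 - 9/20`), in order. In an unsuccessful round the rate is `0`. -/
def boostRounds (erm : TrainSeq X → Hyp X) (S : TrainSeq X) :
    List (List unitInterval) → (Fin S.length → ℝ) → List (Hyp X)
  | [], _ => []
  | u :: r, D =>
    let h := erm (resample S D u)
    if loss S D h ≤ 1 / 2 - 9 / 20 then
      h :: boostRounds erm S r (reweight S D stepSize h)
    else
      boostRounds erm S r (reweight S D 0 h)

/-- The real-valued majority vote `∑ᵢ hᵢ(x) / t` of a list of `t` voters. -/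
def vote (f : List (Hyp X)) (x : X) : ℝ :=
  (f.map (fun h => (h x).toReal)).sum / f.length

open Classical in
/-- The fraction of the examples of `S` on which the vote `f` has margin at most `θ`. -/
def marginLoss (θ : ℝ) (f : List (Hyp X)) (S : TrainSeq X) : ℝ :=
  (S.map (fun z => if vote f z.1 * z.2.toReal ≤ θ then (1 : ℝ) else 0)).sum / S.length

open Classical in
/-- The boosting algorithm, run on `S` and the string `r`. A majority vote is given by the list of
its `t` voters. The vote of the first `t` successful rounds is returned if there are that many and
if it has margin more than `3/4` on all of `S`; otherwise `erm S`, as a vote of `t` copies. -/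
def adaBoostSample (erm : TrainSeq X → Hyp X) (S : TrainSeq X) (r : List (List unitInterval)) :
    List (Hyp X) :=
  let t := numVoters S.length
  let hs := boostRounds erm S r (fun _ => 1 / (S.length : ℝ))
  if t ≤ hs.length ∧ marginLoss (3 / 4) (hs.take t) S < 1 / (S.length : ℝ) then hs.take t
  else List.replicate t (erm S)

/-- The majority voters obtained from the sub training sequences that `S` and `T` give rise to,
one for each of them. -/
def voters (erm : TrainSeq X → Hyp X) (S T : TrainSeq X) (r : List (List unitInterval)) :
    List (List (Hyp X)) :=
  (subsample S T).map (fun S' => adaBoostSample erm S' r)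

/-- The fraction of the voters in `f` that agree with `c` at `x`. -/
def correctFrac (c : Hyp X) (f : List (Hyp X)) (x : X) : ℝ :=
  (f.map (fun h => if h x = c x then (1 : ℝ) else 0)).sum / f.length

open Classical in
/-- The fraction of the majority voters in `F` that have at least `3/4` of their voters agree
with `c` at `x`. -/
def goodFrac (c : Hyp X) (F : List (List (Hyp X))) (x : X) : ℝ :=
  (F.map (fun f => if 3 / 4 ≤ correctFrac c f x then (1 : ℝ) else 0)).sum / F.length

end OptPAC

end

/-!
The error bound is proved by induction on the size `6 ^ k` of the sample, with Hanneke's recursion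
for subsampling, and rests on a uniform margin bound of *constant* relative accuracy.

**Recursion** (`ErrBound.step`, `real_errSet_flatten_le`). Let `E i`, `i < 5`, be the error set of
the list of votes that comes from the `i`-th recursive call. At a point of the total error set more
than a quarter of all votes are bad, hence some `E i` contains the point, and among the votes of
the other four calls at least one sixteenth are bad there. Averaging over the point bounds the
probability of the total error set by `80` times the largest probability of
`E i ∩ {f is bad}`, where `f` is a vote of another call `j ≠ i`. Every such `f` was trained on a
sequence that contains the block `S (j + 1)`, which is independent of `E i`, because `E i` depends
on the blocks `0` and `i + 1` only. By induction `E i` has probability at most `6 · 6` times the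
bound to be shown (one factor for the size of the sample, one for the smaller `δ`), so it is enough
that `f` is bad on at most the fraction `1 / (80 · 36) = 1 / 2880` of `E i`.

**What boosting contributes** (`adaBoostSample_spec`). The output is either a vote with margin more
than `3 / 4` on the whole training sequence or a constant vote consistent with it. In both cases at
least `7 / 8` of the voters are correct at each training example, and all voters lie in `H`. A bad
point of `f` is one where less than `3 / 4` of the voters are correct.

**Margin bound** (`margin_generalization`). Let `w x` be the fraction of voters that err at `x`,
and `R` a fixed region. Then `w ^ q` is the average, over all `q`-tuples of voters, of the indicator
of the set where the whole tuple errs. On sample points in `R` one has `w ^ q ≤ 8 ^ (-q)`, on bad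
points `w ^ q ≥ 4 ^ (-q)`; for large `q` this gap turns a deviation bound for the joint error sets
of `q`-tuples into the wanted bound for the votes.

**Deviation bound** (`joint_error_deviation`). For a sample `S` and a ghost sample `S'`, weight the
tuple `h` by `(1/2) ^ a * (3/2) ^ b * ρ ^ N`, where `a` and `b` count the joint errors in `S` and
`S'`, and `N` the points in `R`. Swapping entries of `S` and `S'` at random makes the mean of the
first two factors at most `1`. With `ρ = (1 + x) ^ (-q)` for a small `x > 0`, the last factor pays
for the number of traces of `q`-tuples from `H` on the points in `R`, which by the Sauer-Shelah
lemma is at most the `q`-th power of `x ^ (-d) * (1 + x) ^ N`. So the supremum over `h` has mean at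
most `x ^ (-d * q)`. Integrating out `S'` and applying Markov's inequality gives the bound. Only
points in `R` are charged for, which is why no factor logarithmic in the sample size appears.
-/

noncomputable section

namespace OptPAC

/-! ### Traces of a class of finite VC-dimension -/

/-- Sauer-Shelah in generating function form: a class of VC-dimension `d` has at most
`x ^ (-d) * (1 + x) ^ |A|` traces on a finite set `A`, for every `x` in `(0, 1]`. -/
theorem exists_traces {X : Type*} {H : Set (Hyp X)} {d : ℕ} (hd : HasVCDim H d) (A : Finset X)
    {x : ℝ} (hx : 0 < x) (hx1 : x ≤ 1) :
    ∃ R : Finset (Hyp X), (∀ h ∈ H, ∃ h' ∈ R, ∀ a ∈ A, h' a = h a) ∧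
      (R.card : ℝ) * x ^ d ≤ (1 + x) ^ A.card := by
  classical
  let 𝒜 : Finset (Finset A) := Finset.univ.filter fun s => ∃ h ∈ H, ∀ a : A, a ∈ s ↔ h a = 1
  have key : ∀ s : Finset A, ∃ h : Hyp X, s ∈ 𝒜 → h ∈ H ∧ ∀ a : A, a ∈ s ↔ h a = 1 := by
    intro s
    by_cases hs : s ∈ 𝒜
    · obtain ⟨h, h1, h2⟩ := (Finset.mem_filter.1 hs).2
      exact ⟨h, fun _ => ⟨h1, h2⟩⟩
    · exact ⟨fun _ => 1, fun h => absurd h hs⟩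
  choose rep hrep using key
  refine ⟨𝒜.image rep, ?_, ?_⟩
  · intro h hh
    have hs : (Finset.univ.filter fun a : A => h a = 1) ∈ 𝒜 :=
      Finset.mem_filter.2 ⟨Finset.mem_univ _, h, hh, by simp⟩
    refine ⟨_, Finset.mem_image_of_mem _ hs, fun a ha => ?_⟩
    have h2 := (hrep _ hs).2 ⟨a, ha⟩
    simp only [Finset.mem_filter, Finset.mem_univ, true_and] at h2
    rcases Int.units_eq_one_or (h a) with h3 | h3
    · rw [h3, ← h2, h3]
    · rcases Int.units_eq_one_or (rep _ a) with h4 | h4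
      · rw [h4, h2.2 h4]
      · rw [h3, h4]
  · have hvc : 𝒜.vcDim ≤ d := by
      refine Finset.sup_le fun B hB => ?_
      rw [Finset.mem_shatterer] at hB
      refine hd.2 ⟨fun i => (B.equivFin.symm i : A), fun y => ?_⟩
      obtain ⟨u, hu, hBu⟩ := hB (t := B.filter fun b => ∃ hb : b ∈ B, y (B.equivFin ⟨b, hb⟩) = 1)
        (Finset.filter_subset _ _)
      obtain ⟨h, hh, hhu⟩ := (Finset.mem_filter.1 hu).2
      refine ⟨h, hh, fun i => ?_⟩
      have hmem := (B.equivFin.symm i).2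
      have h1 : ((B.equivFin.symm i : A) ∈ u) ↔ y i = 1 := by
        have := Finset.ext_iff.1 hBu (B.equivFin.symm i : A)
        simpa [hmem] using this
      rw [hhu] at h1
      rcases Int.units_eq_one_or (y i) with h3 | h3
      · rw [h3, h1.2 h3]
      · rcases Int.units_eq_one_or (h (B.equivFin.symm i : A)) with h4 | h4
        · rw [h4, h1.1 h4]
        · rw [h3, h4]
    have hcard : (𝒜.image rep).card ≤ ∑ k ∈ Finset.Iic d, A.card.choose k := by
      refine Finset.card_image_le.trans <| (Finset.card_le_card_shatterer 𝒜).trans <|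
        Finset.card_shatterer_le_sum_vcDim.trans ?_
      rw [Fintype.card_coe]
      exact Finset.sum_le_sum_of_subset (Finset.Iic_subset_Iic.2 hvc)
    calc ((𝒜.image rep).card : ℝ) * x ^ d
        ≤ (∑ k ∈ Finset.Iic d, (A.card.choose k : ℝ)) * x ^ d := by
          gcongr; exact_mod_cast hcard
      _ ≤ ∑ k ∈ Finset.Iic d, (A.card.choose k : ℝ) * x ^ k := by
          rw [Finset.sum_mul]
          refine Finset.sum_le_sum fun k hk => ?_
          gcongr ?_ * ?_
          exact pow_le_pow_of_le_one hx.le hx1 (Finset.mem_Iic.1 hk)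
      _ ≤ ∑ k ∈ Finset.range (max d A.card + 1), (A.card.choose k : ℝ) * x ^ k := by
          refine Finset.sum_le_sum_of_subset_of_nonneg (fun k hk => ?_) fun _ _ _ => by positivity
          simp only [Finset.mem_Iic, Finset.mem_range] at *
          omega
      _ = ∑ k ∈ Finset.range (A.card + 1), (A.card.choose k : ℝ) * x ^ k := by
          symm
          refine Finset.sum_subset (fun k hk => ?_) fun k _ hk => ?_
          · simp only [Finset.mem_range] at *; omega
          · rw [Nat.choose_eq_zero_of_lt (by simpa using hk)]; simp
      _ = (1 + x) ^ A.card := by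
          rw [add_comm 1 x, add_pow]
          exact Finset.sum_congr rfl fun k _ => by ring

/-! ### Symmetrization with weights -/

open Classical in
/-- The weight `ρ` on the region `R` and `1` outside. -/
def regionWeight {X : Type*} (R : Set X) (ρ : ℝ) (x : X) : ℝ := if x ∈ R then ρ else 1

/-- The part of the region `R` where all members of the tuple `h` differ from `c`. -/
def jointError {X : Type*} {q : ℕ} (c : Hyp X) (R : Set X) (h : Fin q → Hyp X) : Set X :=
  {x | x ∈ R ∧ ∀ i, h i x ≠ c x}

open Classical in
/-- The weight of a point in the symmetrization argument: `regionWeight`, times `b` on the joint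
error set of `h`. The sample is weighted with `b = 1 / 2`, the ghost sample with `b = 3 / 2`. -/
def tilt {X : Type*} {q : ℕ} (c : Hyp X) (R : Set X) (ρ b : ℝ) (h : Fin q → Hyp X) (x : X) : ℝ :=
  regionWeight R ρ x * if x ∈ jointError c R h then b else 1

theorem regionWeight_nonneg {X : Type*} (R : Set X) {ρ : ℝ} (hρ : 0 ≤ ρ) (x : X) :
    0 ≤ regionWeight R ρ x := by
  unfold regionWeight; split_ifs <;> linarith

theorem tilt_nonneg {X : Type*} {q : ℕ} (c : Hyp X) (R : Set X) {ρ b : ℝ} (hρ : 0 ≤ ρ)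
    (hb : 0 ≤ b) (h : Fin q → Hyp X) (x : X) : 0 ≤ tilt c R ρ b h x := by
  refine mul_nonneg (regionWeight_nonneg R hρ x) ?_
  split_ifs <;> linarith

/-- The mean of the two factors `1 / 2` and `3 / 2` is `1`, and their product is less than `1`; so
exchanging a sample point with its ghost at random leaves a mean of at most the region weights. -/
theorem tilt_add_swap_le {X : Type*} {q : ℕ} (c : Hyp X) (R : Set X) {ρ : ℝ} (hρ : 0 ≤ ρ)
    (h : Fin q → Hyp X) (a b : X) :
    tilt c R ρ (1 / 2) h a * tilt c R ρ (3 / 2) h b +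
      tilt c R ρ (1 / 2) h b * tilt c R ρ (3 / 2) h a ≤
      2 * (regionWeight R ρ a * regionWeight R ρ b) := by
  have := mul_nonneg (regionWeight_nonneg R hρ a) (regionWeight_nonneg R hρ b)
  unfold tilt
  split_ifs <;> linarith

/-- Exchange the components of the pairs whose index is selected by `σ`. -/
def swapPairs {X : Type*} {n : ℕ} (σ : Fin n → Bool) (L : Fin n → X × X) : Fin n → X × X :=
  fun i => if σ i then (L i).swap else L i

/-- The symmetrized weights, for fixed points. All `σ` involve the same points, so the supremum can
be replaced by a sum over one tuple of representatives for each trace, independent of `σ`. -/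
theorem sum_swapPairs_le {X : Type*} {H : Set (Hyp X)} {d : ℕ} (hd : HasVCDim H d) (c : Hyp X)
    (R : Set X) (q : ℕ) {x : ℝ} (hx : 0 < x) (hx1 : x ≤ 1) {n : ℕ} (L : Fin n → X × X) :
    ∑ σ : Fin n → Bool, ⨆ h : {h : Fin q → Hyp X // ∀ i, h i ∈ H},
      ENNReal.ofReal (∏ i, (tilt c R ((1 + x) ^ q)⁻¹ (1 / 2) h.1 (swapPairs σ L i).1 *
        tilt c R ((1 + x) ^ q)⁻¹ (3 / 2) h.1 (swapPairs σ L i).2))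
      ≤ 2 ^ n * ENNReal.ofReal ((x ^ (d * q))⁻¹) := by
  classical
  set ρ : ℝ := ((1 + x) ^ q)⁻¹ with hρdef
  have hρ : 0 < ρ := by positivity
  have hρ1 : ρ ≤ 1 := inv_le_one_of_one_le₀ (one_le_pow₀ (by linarith))
  -- the points of `L` that lie in the region, on which the traces are counted
  let A : Finset X := (Finset.univ.image (fun i => (L i).1) ∪
    Finset.univ.image (fun i => (L i).2)).filter (· ∈ R)
  obtain ⟨reps, hreps, hcard⟩ := exists_traces hd A hx hx1
  let G : Finset (Fin q → Hyp X) := Fintype.piFinset fun _ => reps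
  let w : (Fin q → Hyp X) → X × X → ℝ := fun h z =>
    tilt c R ρ (1 / 2) h z.1 * tilt c R ρ (3 / 2) h z.2
  have hw : ∀ h z, 0 ≤ w h z := fun h z =>
    mul_nonneg (tilt_nonneg c R hρ.le (by norm_num) h _)
      (tilt_nonneg c R hρ.le (by norm_num) h _)
  have hA : ∀ i, ((L i).1 ∈ R → (L i).1 ∈ A) ∧ ((L i).2 ∈ R → (L i).2 ∈ A) := by
    intro i
    constructor <;> intro h <;> simp [A, h]
  have hmem : ∀ (σ : Fin n → Bool) i,
      ((swapPairs σ L i).1 ∈ R → (swapPairs σ L i).1 ∈ A) ∧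
      ((swapPairs σ L i).2 ∈ R → (swapPairs σ L i).2 ∈ A) := by
    intro σ i
    have := hA i
    unfold swapPairs
    split_ifs <;> simp_all
  have htilt : ∀ (b : ℝ) (h h' : Fin q → Hyp X), (∀ i, ∀ a ∈ A, h' i a = h i a) →
      ∀ y, (y ∈ R → y ∈ A) → tilt c R ρ b h' y = tilt c R ρ b h y := by
    intro b h h' hh y hy
    have : (y ∈ jointError c R h') ↔ y ∈ jointError c R h := by
      simp only [jointError, Set.mem_ofPred_eq]
      refine and_congr_right fun hyR => forall_congr' fun i => ?_
      rw [hh i y (hy hyR)]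
    simp only [tilt, this]
  have hsup : ∀ σ : Fin n → Bool, (⨆ h : {h : Fin q → Hyp X // ∀ i, h i ∈ H},
      ENNReal.ofReal (∏ i, w h.1 (swapPairs σ L i))) ≤
      ENNReal.ofReal (∑ h ∈ G, ∏ i, w h (swapPairs σ L i)) := by
    intro σ
    refine iSup_le fun h => ENNReal.ofReal_le_ofReal ?_
    choose h' h'R h'A using fun i => hreps (h.1 i) (h.2 i)
    have hG : h' ∈ G := Fintype.mem_piFinset.2 h'R
    refine le_trans (le_of_eq ?_) (Finset.single_le_sum
      (f := fun h => ∏ i, w h (swapPairs σ L i))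
      (fun h _ => Finset.prod_nonneg fun i _ => hw h _) hG)
    refine Finset.prod_congr rfl fun i _ => ?_
    simp only [w]
    rw [htilt _ h.1 h' h'A _ (hmem σ i).1, htilt _ h.1 h' h'A _ (hmem σ i).2]
  have hswap : ∀ h : Fin q → Hyp X, ∑ σ : Fin n → Bool, ∏ i, w h (swapPairs σ L i) ≤
      2 ^ n * ρ ^ A.card := by
    intro h
    have h1 : ∑ σ : Fin n → Bool, ∏ i, w h (swapPairs σ L i) =
        ∏ i, ∑ b : Bool, w h (if b then (L i).swap else L i) := by
      rw [Finset.prod_univ_sum, Fintype.piFinset_univ]; rfl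
    have h2 : ∀ i, ∑ b : Bool, w h (if b then (L i).swap else L i) ≤
        2 * (regionWeight R ρ (L i).1 * regionWeight R ρ (L i).2) := by
      intro i
      have := tilt_add_swap_le c R hρ.le h (L i).1 (L i).2
      simp only [Fintype.sum_bool, if_true, w, Prod.fst_swap, Prod.snd_swap]
      simp only [Bool.false_eq_true, if_false]
      linarith
    have h3 : ∏ i, (regionWeight R ρ (L i).1 * regionWeight R ρ (L i).2) ≤ ρ ^ A.card := by
      have e : ∀ y, regionWeight R ρ y = ρ ^ (if y ∈ R then 1 else 0) := by
        intro y; unfold regionWeight; split_ifs <;> simp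
      simp only [e, ← pow_add, Finset.prod_pow_eq_pow_sum]
      refine pow_le_pow_of_le_one hρ.le hρ1 ?_
      rw [Finset.sum_add_distrib, ← Finset.card_filter, ← Finset.card_filter]
      simp only [A, Finset.filter_union]
      refine (Finset.card_union_le _ _).trans ?_
      rw [Finset.filter_image, Finset.filter_image]
      exact add_le_add Finset.card_image_le Finset.card_image_le
    rw [h1]
    calc _ ≤ ∏ i : Fin n, 2 * (regionWeight R ρ (L i).1 * regionWeight R ρ (L i).2) :=
          Finset.prod_le_prod (fun i _ => Finset.sum_nonneg fun b _ => hw _ _) fun i _ => h2 i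
      _ ≤ 2 ^ n * ρ ^ A.card := by
          rw [Finset.prod_mul_distrib, Finset.prod_const, Finset.card_univ, Fintype.card_fin]
          gcongr
  have hcount : (G.card : ℝ) * ρ ^ A.card ≤ (x ^ (d * q))⁻¹ := by
    have hc : (reps.card : ℝ) ≤ (1 + x) ^ A.card * (x ^ d)⁻¹ := by
      rw [← div_eq_mul_inv, le_div_iff₀ (by positivity)]; exact hcard
    have : (G.card : ℝ) = (reps.card : ℝ) ^ q := by
      simp [G, Fintype.card_piFinset]
    rw [this]
    calc (reps.card : ℝ) ^ q * ρ ^ A.card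
        ≤ ((1 + x) ^ A.card * (x ^ d)⁻¹) ^ q * ρ ^ A.card := by gcongr
      _ = (x ^ (d * q))⁻¹ := by
          have h1x : (1 + x) ≠ 0 := by positivity
          rw [hρdef, mul_pow, inv_pow, inv_pow, ← pow_mul, ← pow_mul, ← pow_mul,
            mul_comm q A.card]
          field_simp
  calc _ ≤ ∑ σ : Fin n → Bool, ENNReal.ofReal (∑ h ∈ G, ∏ i, w h (swapPairs σ L i)) :=
        Finset.sum_le_sum fun σ _ => hsup σ
    _ = ENNReal.ofReal (∑ h ∈ G, ∑ σ : Fin n → Bool, ∏ i, w h (swapPairs σ L i)) := by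
        rw [← ENNReal.ofReal_sum_of_nonneg fun σ _ => Finset.sum_nonneg fun h _ =>
          Finset.prod_nonneg fun i _ => hw _ _, Finset.sum_comm]
    _ ≤ ENNReal.ofReal (2 ^ n * (x ^ (d * q))⁻¹) := by
        refine ENNReal.ofReal_le_ofReal ?_
        calc _ ≤ ∑ h ∈ G, (2 : ℝ) ^ n * ρ ^ A.card := Finset.sum_le_sum fun h _ => hswap h
          _ = 2 ^ n * (G.card * ρ ^ A.card) := by
              rw [Finset.sum_const, nsmul_eq_mul]; ring
          _ ≤ _ := by gcongr
    _ = _ := by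
        rw [ENNReal.ofReal_mul (by positivity), ENNReal.ofReal_pow (by norm_num)]; simp

/-- The supremum over all tuples of the weight of a sample and its ghost sample has bounded mean. -/
theorem lintegral_iSup_tilt_le {X : Type*} [Countable X] [MeasurableSpace X]
    [DiscreteMeasurableSpace X] (D : Measure X) [IsProbabilityMeasure D]
    {H : Set (Hyp X)} {d : ℕ} (hd : HasVCDim H d) (c : Hyp X)
    (R : Set X) (q : ℕ) {x : ℝ} (hx : 0 < x) (hx1 : x ≤ 1) (n : ℕ) :
    ∫⁻ L, ⨆ h : {h : Fin q → Hyp X // ∀ i, h i ∈ H},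
      ENNReal.ofReal (∏ i, (tilt c R ((1 + x) ^ q)⁻¹ (1 / 2) h.1 (L i).1 *
        tilt c R ((1 + x) ^ q)⁻¹ (3 / 2) h.1 (L i).2))
      ∂(Measure.pi fun _ : Fin n => D.prod D) ≤ ENNReal.ofReal ((x ^ (d * q))⁻¹) := by
  set Φ : (Fin n → X × X) → ENNReal := fun L =>
    ⨆ h : {h : Fin q → Hyp X // ∀ i, h i ∈ H},
      ENNReal.ofReal (∏ i, (tilt c R ((1 + x) ^ q)⁻¹ (1 / 2) h.1 (L i).1 *
        tilt c R ((1 + x) ^ q)⁻¹ (3 / 2) h.1 (L i).2)) with hΦ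
  have hσ : ∀ σ : Fin n → Bool, ∫⁻ L, Φ (swapPairs σ L) ∂(Measure.pi fun _ => D.prod D) =
      ∫⁻ L, Φ L ∂(Measure.pi fun _ => D.prod D) := by
    intro σ
    have hmp : MeasurePreserving (swapPairs σ : (Fin n → X × X) → _)
        (Measure.pi fun _ => D.prod D) (Measure.pi fun _ => D.prod D) := by
      refine measurePreserving_pi (fun _ => D.prod D) (fun _ => D.prod D)
        (f := fun i z => if σ i then z.swap else z) fun i => ?_
      by_cases h : σ i
      · simpa [h] using Measure.measurePreserving_swap (μ := D) (ν := D)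
      · simp only [h]; exact MeasurePreserving.id _
    exact hmp.lintegral_comp .of_discrete
  -- the law of `L` is invariant under every `σ`, so the average over all `σ` can be bounded instead
  have h2 : (2 : ENNReal) ^ n * ∫⁻ L, Φ L ∂(Measure.pi fun _ => D.prod D) ≤
      2 ^ n * ENNReal.ofReal ((x ^ (d * q))⁻¹) := by
    calc _ = ∑ σ : Fin n → Bool, ∫⁻ L, Φ (swapPairs σ L) ∂(Measure.pi fun _ => D.prod D) := by
          simp [hσ]
      _ = ∫⁻ L, ∑ σ : Fin n → Bool, Φ (swapPairs σ L) ∂(Measure.pi fun _ => D.prod D) :=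
          (lintegral_finsetSum _ fun _ _ => .of_discrete).symm
      _ ≤ ∫⁻ _, 2 ^ n * ENNReal.ofReal ((x ^ (d * q))⁻¹)
            ∂(Measure.pi fun _ : Fin n => D.prod D) :=
          lintegral_mono fun L => sum_swapPairs_le hd c R q hx hx1 L
      _ = _ := by simp
  exact (ENNReal.mul_le_mul_iff_right (by simp) (by simp)).1 h2

/-! ### Integrating out the ghost sample -/

theorem lintegral_pi_prod {X : Type*} [Countable X] [MeasurableSpace X]
    [DiscreteMeasurableSpace X] (D : Measure X) [IsProbabilityMeasure D] (n : ℕ)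
    (f : X → ENNReal) :
    ∫⁻ S, ∏ i, f (S i) ∂(Measure.pi fun _ : Fin n => D) = (∫⁻ x, f x ∂D) ^ n := by
  have hind := ProbabilityTheory.iIndepFun_pi (μ := fun _ : Fin n => D) (X := fun _ => f)
    fun _ => Measurable.of_discrete.aemeasurable
  rw [ProbabilityTheory.lintegral_prod_eq_prod_lintegral_of_indepFun _ _ hind
    fun _ => .of_discrete]
  simp_rw [fun i : Fin n => (measurePreserving_eval (fun _ : Fin n => D) i).lintegral_comp
    (f := f) .of_discrete]
  simp

theorem integral_tilt {X : Type*} [Countable X] [MeasurableSpace X]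
    [DiscreteMeasurableSpace X] (D : Measure X) [IsProbabilityMeasure D] {q : ℕ} (c : Hyp X)
    (R : Set X) {ρ : ℝ} (hρ : 0 ≤ ρ) (h : Fin q → Hyp X) :
    ∫⁻ x, ENNReal.ofReal (tilt c R ρ (3 / 2) h x) ∂D =
      ENNReal.ofReal (1 - (1 - ρ) * D.real R + ρ / 2 * D.real (jointError c R h)) := by
  have e : ∀ x, tilt c R ρ (3 / 2) h x = 1 - (1 - ρ) * R.indicator 1 x +
      ρ / 2 * (jointError c R h).indicator 1 x := by
    intro x
    by_cases h1 : x ∈ R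
    · by_cases h2 : x ∈ jointError c R h
      · simp [tilt, regionWeight, h1, h2]; ring
      · simp [tilt, regionWeight, h1, h2]
    · have h2 : x ∉ jointError c R h := fun h2 => h1 h2.1
      simp [tilt, regionWeight, h1, h2]
  have hi : ∀ A : Set X, Integrable (A.indicator (1 : X → ℝ)) D := fun A =>
    (integrable_const (1 : ℝ)).indicator (.of_discrete)
  have hint : ∀ A : Set X, ∫ x, A.indicator (1 : X → ℝ) x ∂D = D.real A := fun A =>
    integral_indicator_one .of_discrete
  have hi1 : Integrable (fun x => 1 - (1 - ρ) * R.indicator (1 : X → ℝ) x) D :=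
    (integrable_const 1).sub ((hi R).const_mul _)
  have hi2 : Integrable (fun x => ρ / 2 * (jointError c R h).indicator (1 : X → ℝ) x) D :=
    (hi _).const_mul _
  rw [← ofReal_integral_eq_lintegral_ofReal]
  · congr 1
    simp_rw [e]
    rw [integral_add hi1 hi2, integral_sub (integrable_const 1) ((hi R).const_mul _),
      integral_const_mul, integral_const_mul, hint, hint]
    simp
  · exact (hi1.add hi2).congr (Filter.Eventually.of_forall fun x => (e x).symm)
  · exact Filter.Eventually.of_forall fun x => tilt_nonneg c R hρ (by norm_num) h x

/-- The ghost sample is integrated out inside the supremum, and Markov's inequality is applied.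
The `n`-th power on the right is the mean weight of the ghost sample. -/
theorem measure_tilt_ge_le {X : Type*} [Countable X] [MeasurableSpace X]
    [DiscreteMeasurableSpace X] (D : Measure X) [IsProbabilityMeasure D]
    {H : Set (Hyp X)} {d : ℕ} (hd : HasVCDim H d) (c : Hyp X)
    (R : Set X) (q : ℕ) {x : ℝ} (hx : 0 < x) (hx1 : x ≤ 1) (n : ℕ) {δ : ℝ} (hδ : 0 < δ) :
    (Measure.pi fun _ : Fin n => D)
      {S | ∃ h : Fin q → Hyp X, (∀ i, h i ∈ H) ∧
        (x ^ (d * q))⁻¹ / δ ≤ (∏ i, tilt c R ((1 + x) ^ q)⁻¹ (1 / 2) h (S i)) *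
          (1 - (1 - ((1 + x) ^ q)⁻¹) * D.real R +
            ((1 + x) ^ q)⁻¹ / 2 * D.real (jointError c R h)) ^ n} ≤ ENNReal.ofReal δ := by
  set ρ : ℝ := ((1 + x) ^ q)⁻¹ with hρdef
  have hρ : 0 < ρ := by positivity
  have hρ1 : ρ ≤ 1 := inv_le_one_of_one_le₀ (one_le_pow₀ (by linarith))
  set m : (Fin q → Hyp X) → ℝ := fun h =>
    1 - (1 - ρ) * D.real R + ρ / 2 * D.real (jointError c R h) with hm
  have hm0 : ∀ h, 0 ≤ m h := by
    intro h
    have h1 : D.real R ≤ 1 := measureReal_le_one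
    have h2 : 0 ≤ D.real (jointError c R h) := measureReal_nonneg
    have h3 : (1 - ρ) * D.real R ≤ (1 - ρ) * 1 := by gcongr
    have : 0 ≤ ρ / 2 * D.real (jointError c R h) := by positivity
    simp only [m]
    linarith
  have hu : ∀ (h : Fin q → Hyp X) y, 0 ≤ tilt c R ρ (1 / 2) h y := fun h y =>
    tilt_nonneg c R hρ.le (by norm_num) h y
  have hv : ∀ (h : Fin q → Hyp X) y, 0 ≤ tilt c R ρ (3 / 2) h y := fun h y =>
    tilt_nonneg c R hρ.le (by norm_num) h y
  set Y : (Fin n → X) → ENNReal := fun S => ⨆ h : {h : Fin q → Hyp X // ∀ i, h i ∈ H},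
    ENNReal.ofReal ((∏ i, tilt c R ρ (1 / 2) h.1 (S i)) * m h.1 ^ n) with hY
  have hYE : ∫⁻ S, Y S ∂(Measure.pi fun _ : Fin n => D) ≤ ENNReal.ofReal ((x ^ (d * q))⁻¹) := by
    refine le_trans ?_ (lintegral_iSup_tilt_le D hd c R q hx hx1 n)
    have hmp := measurePreserving_arrowProdEquivProdArrow X X (Fin n) (fun _ => D) (fun _ => D)
    have e := hmp.lintegral_comp (f := fun z : (Fin n → X) × (Fin n → X) =>
      ⨆ h : {h : Fin q → Hyp X // ∀ i, h i ∈ H},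
      ENNReal.ofReal (∏ i, (tilt c R ρ (1 / 2) h.1 (z.1 i) *
        tilt c R ρ (3 / 2) h.1 (z.2 i)))) .of_discrete
    refine le_trans ?_ (le_of_eq e.symm)
    rw [lintegral_prod _ Measurable.of_discrete.aemeasurable]
    refine lintegral_mono fun S => iSup_le fun h => ?_
    have e2 : ENNReal.ofReal ((∏ i, tilt c R ρ (1 / 2) h.1 (S i)) * m h.1 ^ n) =
        ∫⁻ S' : Fin n → X, ENNReal.ofReal (∏ i, (tilt c R ρ (1 / 2) h.1 (S i) *
          tilt c R ρ (3 / 2) h.1 (S' i))) ∂(Measure.pi fun _ : Fin n => D) := by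
      rw [ENNReal.ofReal_mul (Finset.prod_nonneg fun i _ => hu _ _),
        ENNReal.ofReal_pow (hm0 _), ← integral_tilt D c R hρ.le h.1, ← lintegral_pi_prod,
        ← lintegral_const_mul _ .of_discrete]
      refine lintegral_congr fun S' => ?_
      rw [Finset.prod_mul_distrib, ENNReal.ofReal_mul (Finset.prod_nonneg fun i _ => hu _ _),
        ENNReal.ofReal_prod_of_nonneg (f := fun i => tilt c R ρ (3 / 2) h.1 (S' i))
          fun i _ => hv _ _]
    rw [e2]
    exact lintegral_mono fun S' => le_iSup (fun h : {h : Fin q → Hyp X // ∀ i, h i ∈ H} =>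
      ENNReal.ofReal (∏ i, (tilt c R ρ (1 / 2) h.1 (S i) *
        tilt c R ρ (3 / 2) h.1 (S' i)))) h
  have hpos : 0 < (x ^ (d * q))⁻¹ / δ := by positivity
  refine (measure_mono ?_).trans ((meas_ge_le_lintegral_div (μ := Measure.pi fun _ : Fin n => D)
    (f := Y) Measurable.of_discrete.aemeasurable (ε := ENNReal.ofReal ((x ^ (d * q))⁻¹ / δ))
    (by simpa using hpos) ENNReal.ofReal_ne_top).trans ?_)
  · rintro S ⟨h, hH, hle⟩
    exact (ENNReal.ofReal_le_ofReal hle).trans (le_iSup (fun h : {h : Fin q → Hyp X //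
      ∀ i, h i ∈ H} => ENNReal.ofReal ((∏ i, tilt c R ρ (1 / 2) h.1 (S i)) * m h.1 ^ n)) ⟨h, hH⟩)
  · refine ENNReal.div_le_of_le_mul (hYE.trans ?_)
    rw [← ENNReal.ofReal_mul hδ.le]
    refine ENNReal.ofReal_le_ofReal (le_of_eq ?_)
    field_simp

/-! ### Deviation of joint errors -/

open Classical in
/-- The number of indices whose sample point lies in `A`. -/
def hits {X : Type*} {n : ℕ} (A : Set X) (S : Fin n → X) : ℕ :=
  (Finset.univ.filter fun i => S i ∈ A).card

/-- Chernoff bound for the number of sample points in `R`. -/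
theorem measure_hits_gt_le {X : Type*} [Countable X] [MeasurableSpace X]
    [DiscreteMeasurableSpace X] (D : Measure X) [IsProbabilityMeasure D]
    (R : Set X) (n : ℕ) {δ : ℝ} (hδ : 0 < δ) (h : Real.log (1 / δ) ≤ n * D.real R) :
    (Measure.pi fun _ : Fin n => D) {S | 4 * (n * D.real R) < hits R S} ≤ ENNReal.ofReal δ := by
  classical
  set p := D.real R with hp
  have hp0 : 0 ≤ p := measureReal_nonneg
  have hE : ∫⁻ S : Fin n → X, ∏ i, ENNReal.ofReal (regionWeight R 2 (S i))
      ∂(Measure.pi fun _ : Fin n => D) ≤ ENNReal.ofReal (Real.exp (n * p)) := by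
    rw [lintegral_pi_prod D n fun y => ENNReal.ofReal (regionWeight R 2 y)]
    have e : ∀ y, ENNReal.ofReal (regionWeight R 2 y) = 1 + R.indicator 1 y := by
      intro y
      by_cases h : y ∈ R
      · simp [regionWeight, h]; norm_num
      · simp [regionWeight, h]
    simp_rw [e]
    rw [lintegral_add_left .of_discrete, lintegral_indicator_one .of_discrete]
    simp only [lintegral_const, measure_univ, mul_one]
    have e2 : (1 : ENNReal) + D R = ENNReal.ofReal (1 + p) := by
      rw [ENNReal.ofReal_add (by norm_num) hp0, hp, measureReal_def,
        ENNReal.ofReal_toReal (measure_ne_top _ _)]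
      simp
    rw [e2, ← ENNReal.ofReal_pow (by positivity), Real.exp_nat_mul]
    refine ENNReal.ofReal_le_ofReal (pow_le_pow_left₀ (by positivity) ?_ n)
    linarith [Real.add_one_le_exp p]
  have hlog : 0.69 < Real.log 2 := by linarith [Real.log_two_gt_d9]
  refine (measure_mono ?_).trans ((meas_ge_le_lintegral_div (μ := Measure.pi fun _ : Fin n => D)
    (f := fun S => ∏ i, ENNReal.ofReal (regionWeight R 2 (S i)))
    Measurable.of_discrete.aemeasurable (ε := ENNReal.ofReal (Real.exp (2 * (n * p))))
    (by simpa using Real.exp_pos _) ENNReal.ofReal_ne_top).trans ?_)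
  · intro S hS
    simp only [Set.mem_ofPred_eq] at hS ⊢
    rw [← ENNReal.ofReal_prod_of_nonneg fun i _ => regionWeight_nonneg R (by norm_num) _]
    refine ENNReal.ofReal_le_ofReal ?_
    have e : ∏ i, regionWeight R 2 (S i) = 2 ^ hits R S := by
      simp [regionWeight, hits, Finset.prod_ite]
    rw [e, ← Real.exp_log (show (0 : ℝ) < 2 by norm_num), ← Real.exp_nat_mul,
      Real.exp_log (by norm_num)]
    refine Real.exp_le_exp.2 ?_
    have : (0 : ℝ) ≤ n * p := by positivity
    nlinarith
  · refine ENNReal.div_le_of_le_mul (hE.trans ?_)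
    rw [← ENNReal.ofReal_mul hδ.le]
    refine ENNReal.ofReal_le_ofReal ?_
    have h1 : Real.exp (Real.log (1 / δ)) = 1 / δ := Real.exp_log (by positivity)
    have h2 : 1 / δ ≤ Real.exp (n * p) := h1 ▸ Real.exp_le_exp.2 h
    have h3 : Real.exp (2 * (n * p)) = Real.exp (n * p) * Real.exp (n * p) := by
      rw [← Real.exp_add]; ring_nf
    rw [h3, ← mul_assoc]
    refine le_mul_of_one_le_left (Real.exp_pos _).le ?_
    rw [div_le_iff₀ hδ] at h2
    linarith

/-- The numerical core of the deviation bound: `N` and `a` are the numbers of sample points in the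
region and in the joint error set, `p` and `P` the probabilities of these two sets. -/
theorem exp_le_tilt_bound {η p P ρ L : ℝ} {n N a : ℕ} (hη : 0 < η) (hη1 : η ≤ 1)
    (hp : 0 ≤ p) (hP : η * p ≤ P) (hP1 : P ≤ 1) (hρ : 0 < ρ) (hlogρ : -Real.log ρ ≤ η / 128)
    (hN : N ≤ 4 * (n * p)) (ha : 16 * a ≤ n * P) (hL : L ≤ η * (n * p) / 32) :
    Real.exp L ≤ ρ ^ N * (1 / 2) ^ a * (1 - (1 - ρ) * p + ρ / 2 * P) ^ n := by
  have hP0 : 0 ≤ P := (by positivity : 0 ≤ η * p).trans hP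
  have hρ1 : 1 - η / 128 ≤ ρ := by
    linarith [Real.log_le_sub_one_of_pos hρ]
  have hmean : Real.exp (P / 8) ≤ 1 - (1 - ρ) * p + ρ / 2 * P := by
    have h1 : (1 - ρ) * p ≤ P / 128 := by
      have : (1 - ρ) * p ≤ η / 128 * p := by gcongr; linarith
      linarith
    have h2 : (1 - 1 / 128) / 2 * P ≤ ρ / 2 * P := by gcongr; linarith
    have h3 : Real.exp (P / 8) ≤ 1 + P / 4 := by
      have := Real.exp_bound_div_one_sub_of_interval (x := P / 8) (by linarith) (by linarith)
      refine this.trans ?_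
      rw [div_le_iff₀ (by linarith)]
      nlinarith
    linarith
  have hrhs : Real.exp (N * Real.log ρ - a * Real.log 2 + n * (P / 8)) =
      ρ ^ N * (1 / 2) ^ a * Real.exp (P / 8) ^ n := by
    rw [Real.exp_add, Real.exp_sub, Real.exp_nat_mul, Real.exp_nat_mul, Real.exp_nat_mul,
      Real.exp_log hρ, Real.exp_log (by norm_num), one_div, inv_pow, div_eq_mul_inv]
  refine le_trans ?_ (mul_le_mul_of_nonneg_left
    (pow_le_pow_left₀ (Real.exp_pos _).le hmean n) (by positivity))
  rw [← hrhs, Real.exp_le_exp]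
  have h1 : N * (-Real.log ρ) ≤ 4 * (n * p) * (η / 128) := by
    have : (N : ℝ) * (-Real.log ρ) ≤ N * (η / 128) := by gcongr
    exact this.trans (by gcongr)
  have h2 : η * (n * p) ≤ n * P := by
    have : (n : ℝ) * (η * p) ≤ n * P := by gcongr
    linarith
  have h3 : a * Real.log 2 ≤ n * P / 16 := by
    have : Real.log 2 ≤ 1 := by linarith [Real.log_two_lt_d9]
    have : a * Real.log 2 ≤ a * 1 := by gcongr
    linarith
  linarith

/-- Deviation bound for joint errors relative to a region `R`: once the expected number of sample
points in `R` is a large constant times `d + log (1 / δ)`, every joint error set that is not too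
small a part of `R` is hit by a fixed fraction of the expected number of sample points. -/
theorem joint_error_deviation {q : ℕ} (hq : 1 ≤ q) {η : ℝ} (hη : 0 < η) (hη1 : η ≤ 1) :
    ∃ K : ℝ, 1 ≤ K ∧ ∀ {X : Type*} [Countable X] [MeasurableSpace X] [DiscreteMeasurableSpace X]
      (D : Measure X) [IsProbabilityMeasure D] {H : Set (Hyp X)} {d : ℕ}, HasVCDim H d →
      ∀ (c : Hyp X) (R : Set X) (n : ℕ) (δ : ℝ), 0 < δ → δ < 1 →
      K * (d + Real.log (1 / δ)) ≤ n * D.real R →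
      (Measure.pi fun _ : Fin n => D)
        {S | 4 * (n * D.real R) < hits R S ∨ ∃ h : Fin q → Hyp X, (∀ i, h i ∈ H) ∧
          η * D.real R ≤ D.real (jointError c R h) ∧
          16 * hits (jointError c R h) S ≤ n * D.real (jointError c R h)} ≤
        ENNReal.ofReal (2 * δ) := by
  have hq0 : (0 : ℝ) < q := by exact_mod_cast hq
  have hq1 : (1 : ℝ) ≤ q := by exact_mod_cast hq
  -- with this `x`, the region weight `ρ = (1 + x) ^ (-q)` costs at most `η / 128` per point of `R`
  set x : ℝ := η / (128 * q) with hxdef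
  have hx : 0 < x := by positivity
  have hx1 : x ≤ 1 := by
    rw [hxdef, div_le_one (by positivity)]; linarith
  have hqx : q * x = η / 128 := by rw [hxdef]; field_simp
  have hlx : 0 ≤ Real.log (1 / x) := Real.log_nonneg (by rw [le_div_iff₀ hx]; linarith)
  have hK : 1 ≤ 32 * (q * Real.log (1 / x) + 1) / η := by
    rw [le_div_iff₀ hη]
    have : 0 ≤ q * Real.log (1 / x) := by positivity
    linarith
  refine ⟨32 * (q * Real.log (1 / x) + 1) / η, hK, ?_⟩
  intro X _ _ _ D _ H d hd c R n δ hδ hδ1 hn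
  set p := D.real R with hp
  have hp0 : 0 ≤ p := measureReal_nonneg
  have hl : 0 < Real.log (1 / δ) := Real.log_pos (by rw [lt_div_iff₀ hδ]; linarith)
  have hl' : Real.log (1 / δ) ≤ n * p := by
    have : (0 : ℝ) ≤ d := by positivity
    nlinarith
  rw [two_mul, ENNReal.ofReal_add hδ.le hδ.le]
  refine (measure_mono ?_).trans ((measure_union_le _ _).trans (add_le_add
    (measure_hits_gt_le D R n hδ hl') (measure_tilt_ge_le D hd c R q hx hx1 n hδ)))
  intro S hS
  by_cases hN : 4 * (n * p) < hits R S
  · exact Or.inl hN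
  right
  obtain ⟨h, hH, hP, ha⟩ := hS.resolve_left hN
  refine ⟨h, hH, ?_⟩
  set P := D.real (jointError c R h) with hPdef
  set a := hits (jointError c R h) S with hadef
  set ρ : ℝ := ((1 + x) ^ q)⁻¹ with hρdef
  push Not at hN
  have hρ : 0 < ρ := by positivity
  -- the weights `ρ` cost at most `η / 128` per point of `R`
  have hlogρ : -Real.log ρ ≤ η / 128 := by
    rw [hρdef, Real.log_inv, Real.log_pow, neg_neg, ← hqx]
    gcongr
    linarith [Real.log_le_sub_one_of_pos (show 0 < 1 + x by linarith)]
  have hprod : ∏ i, tilt c R ρ (1 / 2) h (S i) = ρ ^ hits R S * (1 / 2) ^ a := by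
    simp only [tilt, Finset.prod_mul_distrib]
    simp [regionWeight, hits, Finset.prod_ite, hadef]
  have hlhs : (x ^ (d * q))⁻¹ / δ =
      Real.exp (d * q * Real.log (1 / x) + Real.log (1 / δ)) := by
    rw [Real.exp_add, Real.exp_log (by positivity), mul_comm _ (Real.log _),
      ← Nat.cast_mul, mul_comm _ ((d * q : ℕ) : ℝ), Real.exp_nat_mul, Real.exp_log (by positivity)]
    simp [div_eq_mul_inv]
  rw [hlhs, hprod]
  refine exp_le_tilt_bound hη hη1 hp0 hP measureReal_le_one hρ hlogρ hN ha ?_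
  have h5 : 32 * (q * Real.log (1 / x) + 1) * (d + Real.log (1 / δ)) ≤ η * (n * p) := by
    rw [div_mul_eq_mul_div, div_le_iff₀ hη] at hn
    linarith
  have h6 : 0 ≤ q * Real.log (1 / x) * Real.log (1 / δ) := by positivity
  have h7 : (0 : ℝ) ≤ d := by positivity
  nlinarith

/-! ### Generalization of votes with a margin -/

open Classical in
/-- The fraction of the voters in `f` that differ from `c` at `x`. -/
def wrongFrac {X : Type*} (c : Hyp X) (f : List (Hyp X)) (x : X) : ℝ :=
  (∑ l : Fin f.length, if f.get l x ≠ c x then 1 else 0) / f.length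

theorem wrongFrac_nonneg {X : Type*} (c : Hyp X) (f : List (Hyp X)) (x : X) :
    0 ≤ wrongFrac c f x := by
  unfold wrongFrac; positivity

theorem correctFrac_eq {X : Type*} (c : Hyp X) {f : List (Hyp X)} (hf : f ≠ []) (x : X) :
    correctFrac c f x = 1 - wrongFrac c f x := by
  classical
  have hl : (f.length : ℝ) ≠ 0 := by simpa using hf
  unfold correctFrac wrongFrac
  rw [eq_sub_iff_add_eq, ← add_div, div_eq_one_iff_eq hl]
  have e : (f.map fun h => if h x = c x then (1 : ℝ) else 0).sum =
      ∑ l : Fin f.length, if f.get l x = c x then (1 : ℝ) else 0 := by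
    simpa using (Fin.sum_univ_fun_getElem f fun h => if h x = c x then (1 : ℝ) else 0).symm
  rw [e, ← Finset.sum_add_distrib]
  trans ∑ _l : Fin f.length, (1 : ℝ)
  · exact Finset.sum_congr rfl fun l _ => by split_ifs <;> simp_all
  · simp

/-- The `q`-th power of the fraction of wrong voters is the average over `q`-tuples of voters of the
indicators of their joint error sets. -/
theorem indicator_wrongFrac_pow {X : Type*} (c : Hyp X) (R : Set X) (f : List (Hyp X)) (q : ℕ)
    (x : X) : R.indicator (fun x => wrongFrac c f x ^ q) x =
      (∑ I : Fin q → Fin f.length,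
        (jointError c R fun i => f.get (I i)).indicator 1 x) / (f.length : ℝ) ^ q := by
  classical
  by_cases hx : x ∈ R
  · rw [Set.indicator_of_mem hx, wrongFrac, div_pow, Fintype.sum_pow]
    congr 1
    refine Finset.sum_congr rfl fun I _ => ?_
    rw [Finset.prod_ite_zero]
    simp [jointError, Set.indicator_apply, hx]
  · rw [Set.indicator_of_notMem hx]
    rw [Finset.sum_eq_zero, zero_div]
    intro I _
    exact Set.indicator_of_notMem (fun h => hx h.1) _

theorem sum_real_jointError {X : Type*} [Countable X] [MeasurableSpace X]
    [DiscreteMeasurableSpace X] (D : Measure X) [IsProbabilityMeasure D] (c : Hyp X) (R : Set X)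
    (f : List (Hyp X)) (q : ℕ) :
    ∑ I : Fin q → Fin f.length, D.real (jointError c R fun i => f.get (I i)) =
      ∫ x, ∑ I : Fin q → Fin f.length,
        (jointError c R fun i => f.get (I i)).indicator (1 : X → ℝ) x ∂D := by
  rw [integral_finsetSum _ fun I _ =>
    (integrable_const (1 : ℝ)).indicator (f := (1 : X → ℝ)) .of_discrete]
  exact Finset.sum_congr rfl fun I _ => (integral_indicator_one .of_discrete).symm

theorem hits_eq_sum_indicator {X : Type*} {n : ℕ} (A : Set X) (S : Fin n → X) :
    (hits A S : ℝ) = ∑ i, A.indicator 1 (S i) := by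
  classical
  simp [hits, Set.indicator_apply]

/-- A vote that is correct with margin at all sample points in `R` is bad on at most a fraction `η`
of `R`, uniformly over all votes of members of `H`. The number of voters does not matter. -/
theorem margin_generalization {η : ℝ} (hη : 0 < η) (hη1 : η ≤ 1) :
    ∃ K : ℝ, 1 ≤ K ∧ ∀ {X : Type*} [Countable X] [MeasurableSpace X] [DiscreteMeasurableSpace X]
      (D : Measure X) [IsProbabilityMeasure D] {H : Set (Hyp X)} {d : ℕ}, HasVCDim H d →
      ∀ (c : Hyp X) (R : Set X) (n : ℕ) (δ : ℝ), 0 < δ → δ < 1 →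
      K * (d + Real.log (1 / δ)) ≤ n * D.real R →
      (Measure.pi fun _ : Fin n => D)
        {S | ∃ f : List (Hyp X), f ≠ [] ∧ (∀ h ∈ f, h ∈ H) ∧
          (∀ i, S i ∈ R → 7 / 8 ≤ correctFrac c f (S i)) ∧
          η * D.real R < D.real {x | x ∈ R ∧ correctFrac c f x < 3 / 4}} ≤
        ENNReal.ofReal (2 * δ) := by
  -- `64 * 8 ^ (-q) < 4 ^ (-q) * η / 2`, which decides the final comparison
  obtain ⟨q, hq⟩ := pow_unbounded_of_one_lt (128 / η) (one_lt_two : (1 : ℝ) < 2)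
  have hq1 : 1 ≤ q := by
    by_contra h
    have : q = 0 := by omega
    rw [this, pow_zero, div_lt_one hη] at hq
    linarith
  have h4q : (0 : ℝ) < (1 / 4) ^ q := by positivity
  have h4q1 : ((1 : ℝ) / 4) ^ q ≤ 1 := pow_le_one₀ (by norm_num) (by norm_num)
  obtain ⟨K, hK1, hK⟩ := joint_error_deviation hq1 (η := (1 / 4) ^ q * η / 2) (by positivity)
    (by nlinarith)
  refine ⟨K, hK1, ?_⟩
  intro X _ _ _ D _ H d hd c R n δ hδ hδ1 hn
  refine (measure_mono ?_).trans (hK D hd c R n δ hδ hδ1 hn)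
  rintro S ⟨f, hf, hfH, hS, hbad⟩
  by_contra hcon
  simp only [Set.mem_ofPred_eq, not_or, not_lt, not_exists, not_and, not_le] at hcon
  obtain ⟨hN, hdev⟩ := hcon
  set p := D.real R with hp
  have hp0 : 0 ≤ p := measureReal_nonneg
  set t := f.length with ht
  have ht0 : (0 : ℝ) < (t : ℝ) ^ q := by
    have : 0 < t := List.length_pos_iff.2 hf
    positivity
  have hnp : 0 < n * p := by
    have hl : 0 < Real.log (1 / δ) := Real.log_pos (by rw [lt_div_iff₀ hδ]; linarith)
    have : 0 < K * (d + Real.log (1 / δ)) := by positivity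
    linarith
  set G : (Fin q → Fin t) → Set X := fun I => jointError c R fun i => f.get (I i) with hG
  -- the deviation bound in linear form, which can be averaged over the tuples
  have hI : ∀ I : Fin q → Fin t,
      n * D.real (G I) ≤ 16 * hits (G I) S + n * ((1 / 4) ^ q * η / 2 * p) := by
    intro I
    by_cases h : (1 / 4) ^ q * η / 2 * p ≤ D.real (G I)
    · have := hdev (fun i => f.get (I i)) (fun i => hfH _ (List.get_mem _ _)) h
      have h2 : 0 ≤ n * ((1 / 4) ^ q * η / 2 * p) := by positivity
      linarith
    · push Not at h
      have h2 : n * D.real (G I) ≤ n * ((1 / 4) ^ q * η / 2 * p) := by gcongr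
      have h3 : (0 : ℝ) ≤ hits (G I) S := by positivity
      linarith
  have hsum := Finset.sum_le_sum fun I (_ : I ∈ Finset.univ) => hI I
  rw [← Finset.mul_sum, Finset.sum_add_distrib, ← Finset.mul_sum] at hsum
  have hlow : (1 / 4) ^ q * (η * p) ≤ (∑ I, D.real (G I)) / (t : ℝ) ^ q := by
    have e : (∑ I, D.real (G I)) / (t : ℝ) ^ q =
        ∫ x, R.indicator (fun x => wrongFrac c f x ^ q) x ∂D := by
      rw [sum_real_jointError, ← integral_div]
      exact integral_congr_ae (.of_forall fun x => (indicator_wrongFrac_pow c R f q x).symm)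
    rw [e]
    have hint : Integrable (R.indicator fun x => wrongFrac c f x ^ q) D := by
      rw [funext (indicator_wrongFrac_pow c R f q)]
      exact (integrable_finsetSum _ fun I _ => (integrable_const (1 : ℝ)).indicator
        (f := (1 : X → ℝ)) .of_discrete).div_const _
    have hmk := mul_meas_ge_le_integral_of_nonneg (Filter.Eventually.of_forall fun x =>
      Set.indicator_nonneg (s := R) (f := fun x => wrongFrac c f x ^ q)
        (fun x _ => pow_nonneg (wrongFrac_nonneg c f x) q) x) hint ((1 / 4) ^ q)
    refine le_trans ?_ hmk
    gcongr
    refine hbad.le.trans (measureReal_mono ?_)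
    rintro x ⟨hxR, hx⟩
    simp only [Set.mem_ofPred_eq]
    rw [Set.indicator_of_mem hxR]
    rw [correctFrac_eq c hf] at hx
    exact pow_le_pow_left₀ (by norm_num) (by linarith) q
  have hup : (∑ I, (hits (G I) S : ℝ)) / (t : ℝ) ^ q ≤ 4 * (n * p) * (1 / 8) ^ q := by
    have e : (∑ I, (hits (G I) S : ℝ)) / (t : ℝ) ^ q =
        ∑ i, R.indicator (fun x => wrongFrac c f x ^ q) (S i) := by
      simp_rw [indicator_wrongFrac_pow]
      rw [← Finset.sum_div, Finset.sum_comm]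
      congr 1
      refine Finset.sum_congr rfl fun I _ => ?_
      exact hits_eq_sum_indicator _ _
    rw [e]
    calc _ ≤ ∑ i, R.indicator (fun _ => ((1 : ℝ) / 8) ^ q) (S i) := by
          refine Finset.sum_le_sum fun i _ => ?_
          by_cases h : S i ∈ R
          · rw [Set.indicator_of_mem h, Set.indicator_of_mem h]
            have := hS i h
            rw [correctFrac_eq c hf] at this
            exact pow_le_pow_left₀ (wrongFrac_nonneg c f _) (by linarith) q
          · rw [Set.indicator_of_notMem h, Set.indicator_of_notMem h]
      _ = hits R S * (1 / 8) ^ q := by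
          classical
          simp [hits, Set.indicator_apply, Finset.sum_ite]
      _ ≤ _ := by gcongr
  have hfin : n * ((1 / 4) ^ q * (η * p)) ≤
      16 * (4 * (n * p) * (1 / 8) ^ q) + n * ((1 / 4) ^ q * η / 2 * p) := by
    calc _ ≤ n * ((∑ I, D.real (G I)) / (t : ℝ) ^ q) := by gcongr
      _ = (n * ∑ I, D.real (G I)) / (t : ℝ) ^ q := by ring
      _ ≤ (16 * ∑ I, (hits (G I) S : ℝ) +
            ∑ _I : Fin q → Fin t, n * ((1 / 4) ^ q * η / 2 * p)) / (t : ℝ) ^ q := by gcongr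
      _ = 16 * ((∑ I, (hits (G I) S : ℝ)) / (t : ℝ) ^ q) + n * ((1 / 4) ^ q * η / 2 * p) := by
          rw [Finset.sum_const, Finset.card_univ, Fintype.card_fun, Fintype.card_fin,
            Fintype.card_fin, nsmul_eq_mul, Nat.cast_pow]
          field_simp
      _ ≤ _ := by gcongr
  have h8 : ((1 : ℝ) / 8) ^ q = (1 / 4) ^ q * (1 / 2) ^ q := by
    rw [← mul_pow]; norm_num
  have h2 : (1 / 2 : ℝ) ^ q * 128 < η := by
    rw [div_lt_iff₀ hη] at hq
    rw [one_div, inv_pow, ← div_eq_inv_mul, div_lt_iff₀ (by positivity)]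
    linarith
  rw [h8] at hfin
  have h3 : 0 < (n * p) * (1 / 4) ^ q := by positivity
  nlinarith

/-! ### The boosting algorithm -/

theorem mem_of_mem_resample {X : Type*} {S : TrainSeq X} {D : Fin S.length → ℝ}
    {u : List unitInterval} {z : X × Label} (hz : z ∈ resample S D u) : z ∈ S := by
  obtain ⟨v, _, hv⟩ := List.mem_filterMap.1 hz
  unfold invCDF at hv
  split_ifs at hv with h
  · rw [← Option.some.inj hv]
    exact List.get_mem _ _
  · exact List.mem_of_getLast? hv

theorem mem_of_mem_boostRounds {X : Type*} {H : Set (Hyp X)} {erm : TrainSeq X → Hyp X}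
    (herm : IsERM H erm) {c : Hyp X} (hc : c ∈ H) {S : TrainSeq X} (hS : RealizableBy c S)
    (r : List (List unitInterval)) (D : Fin S.length → ℝ) :
    ∀ h ∈ boostRounds erm S r D, h ∈ H := by
  induction r generalizing D with
  | nil => simp [boostRounds]
  | cons u r ih =>
    have h1 : erm (resample S D u) ∈ H :=
      (herm _ ⟨c, hc, fun z hz => hS z (mem_of_mem_resample hz)⟩).1
    intro h hh
    simp only [boostRounds] at hh
    split_ifs at hh
    · rcases List.mem_cons.1 hh with rfl | hh
      · exact h1
      · exact ih _ h hh
    · exact ih _ h hh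

theorem numVoters_pos {m : ℕ} (hm : 2 ≤ m) : 0 < numVoters m := by
  have : (1 : ℝ) < m := by exact_mod_cast hm
  have := Real.log_pos this
  exact Nat.ceil_pos.2 (by positivity)

/-- The margin of a vote in terms of the fraction of correct voters. -/
theorem vote_eq {X : Type*} {c : Hyp X} {f : List (Hyp X)} (hf : f ≠ []) (x : X) :
    vote f x * (c x).toReal = 2 * correctFrac c f x - 1 := by
  classical
  have hl : (f.length : ℝ) ≠ 0 := by simpa using hf
  have key : ∀ g : List (Hyp X), (g.map fun h => (h x).toReal).sum * (c x).toReal =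
      2 * (g.map fun h => if h x = c x then (1 : ℝ) else 0).sum - g.length := by
    intro g
    induction g with
    | nil => simp
    | cons h g ih =>
      simp only [List.map_cons, List.sum_cons, List.length_cons, add_mul, ih, Nat.cast_add,
        Nat.cast_one]
      rcases Int.units_eq_one_or (h x) with h1 | h1 <;>
        rcases Int.units_eq_one_or (c x) with h2 | h2 <;>
        simp [h1, h2, Label.toReal] <;> ring
  unfold vote correctFrac
  rw [div_mul_eq_mul_div, key]
  field_simp

theorem lt_vote_of_marginLoss_lt {X : Type*} {θ : ℝ} {f : List (Hyp X)} {S : TrainSeq X}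
    (h : marginLoss θ f S < 1 / (S.length : ℝ)) {z : X × Label} (hz : z ∈ S) :
    θ < vote f z.1 * z.2.toReal := by
  classical
  by_contra hcon
  push Not at hcon
  have hpos : (0 : ℝ) < S.length := by exact_mod_cast List.length_pos_of_mem hz
  unfold marginLoss at h
  rw [div_lt_div_iff_of_pos_right hpos] at h
  refine absurd h (not_lt.2 ?_)
  refine List.single_le_sum ?_ _ (List.mem_map.2 ⟨z, hz, if_pos hcon⟩)
  intro a ha
  obtain ⟨w, _, rfl⟩ := List.mem_map.1 ha
  split_ifs <;> norm_num

/-- The length condition makes the number of voters positive: for a single example it is `0`. -/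
theorem adaBoostSample_spec {X : Type*} {H : Set (Hyp X)} {erm : TrainSeq X → Hyp X}
    (herm : IsERM H erm) {c : Hyp X} (hc : c ∈ H) {S : TrainSeq X} (hS : RealizableBy c S)
    (hlen : 2 ≤ S.length) (r : List (List unitInterval)) :
    adaBoostSample erm S r ≠ [] ∧ (∀ h ∈ adaBoostSample erm S r, h ∈ H) ∧
      ∀ z ∈ S, 7 / 8 ≤ correctFrac c (adaBoostSample erm S r) z.1 := by
  have ht := numVoters_pos hlen
  simp only [adaBoostSample]
  split_ifs with h
  · have hne : (boostRounds erm S r fun _ => 1 / (S.length : ℝ)).take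
        (numVoters S.length) ≠ [] := by
      rw [← List.length_pos_iff, List.length_take]
      omega
    refine ⟨hne, fun g hg => mem_of_mem_boostRounds herm hc hS _ _ g (List.mem_of_mem_take hg),
      fun z hz => ?_⟩
    have h1 := lt_vote_of_marginLoss_lt h.2 hz
    rw [← hS z hz, vote_eq hne] at h1
    linarith
  · have he := herm S ⟨c, hc, hS⟩
    have hne : List.replicate (numVoters S.length) (erm S) ≠ [] := by
      rw [← List.length_pos_iff, List.length_replicate]; exact ht
    refine ⟨hne, fun g hg => (List.mem_replicate.1 hg).2 ▸ he.1, fun z hz => ?_⟩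
    have : erm S z.1 = c z.1 := (he.2 z hz).trans (hS z hz).symm
    have h2 : (numVoters S.length : ℝ) ≠ 0 := by exact_mod_cast ht.ne'
    simp [correctFrac, this, h2]
    norm_num

/-! ### The subsampling algorithm -/

theorem mem_of_mem_block {α : Type*} {S : List α} {i : ℕ} {z : α} (hz : z ∈ block S i) :
    z ∈ S :=
  List.mem_of_mem_take (List.mem_of_mem_drop hz)

theorem subsample_eq_flatMap {α : Type*} {S : List α} (h : 6 ≤ S.length) (T : List α) :
    subsample S T = (List.ofFn fun i : Fin 5 =>
      subsample (block S 0) (block S (i + 1) ++ T)).flatten := by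
  rw [subsample, dif_pos h]
  simp [List.ofFn_succ]

theorem subsample_of_lt {α : Type*} {S : List α} (h : ¬ 6 ≤ S.length) (T : List α) :
    subsample S T = [S ++ T] := by
  rw [subsample, dif_neg h]

theorem block_zero_ne_nil {α : Type*} {S : List α} (h : 6 ≤ S.length) : block S 0 ≠ [] := by
  rw [← List.length_pos_iff]
  simp only [block, List.length_drop, List.length_take]
  omega

theorem mem_subsample_spec {α : Type*} {S T S' : List α} (hS : S ≠ [])
    (h' : S' ∈ subsample S T) :
    (∀ z ∈ T, z ∈ S') ∧ (∀ z ∈ S', z ∈ S ∨ z ∈ T) ∧ T.length < S'.length := by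
  by_cases h : 6 ≤ S.length
  · rw [subsample_eq_flatMap h] at h'
    obtain ⟨l, hl, hS'⟩ := List.mem_flatten.1 h'
    obtain ⟨i, rfl⟩ := List.mem_ofFn.1 hl
    obtain ⟨h1, h2, h3⟩ := mem_subsample_spec (block_zero_ne_nil h) hS'
    refine ⟨fun z hz => h1 z (List.mem_append_right _ hz), fun z hz => ?_, ?_⟩
    · rcases h2 z hz with h4 | h4
      · exact Or.inl (mem_of_mem_block h4)
      · exact (List.mem_append.1 h4).imp_left mem_of_mem_block
    · rw [List.length_append] at h3
      omega
  · rw [subsample_of_lt h, List.mem_singleton] at h'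
    subst h'
    refine ⟨fun z hz => List.mem_append_right _ hz, fun z hz => List.mem_append.1 hz, ?_⟩
    have := List.length_pos_iff.2 hS
    rw [List.length_append]
    omega
termination_by S.length
decreasing_by exact length_block_zero_lt S h

theorem length_subsample {α : Type*} (S T T' : List α) :
    (subsample S T).length = (subsample S T').length ∧ 0 < (subsample S T).length := by
  by_cases h : 6 ≤ S.length
  · simp only [subsample_eq_flatMap h, List.length_flatten, List.map_ofFn, List.sum_ofFn,
      Function.comp_apply]
    refine ⟨Finset.sum_congr rfl fun i _ => (length_subsample (block S 0) _ _).1, ?_⟩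
    exact Finset.sum_pos (fun i _ => (length_subsample (block S 0) _ T).2) ⟨0, Finset.mem_univ _⟩
  · simp [subsample_of_lt h]
termination_by S.length
decreasing_by all_goals exact length_block_zero_lt S h

theorem block_flatten {α : Type*} {n : ℕ} (g : Fin 6 → List α) (hg : ∀ i, (g i).length = n)
    (i : Fin 6) : block (List.ofFn g).flatten i = g i := by
  have hmap : (List.ofFn g).map List.length = List.replicate 6 n := by
    rw [List.map_ofFn, ← List.ofFn_const]
    congr 1
    exact funext hg
  have h := List.drop_take_succ_flatten_eq_getElem (List.ofFn g) i (by simp)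
  rw [hmap, List.take_replicate, List.take_replicate, List.sum_replicate, List.sum_replicate,
    List.getElem_ofFn] at h
  have hlen : (List.ofFn g).flatten.length = 6 * n := by
    rw [List.length_flatten, hmap, List.sum_replicate, smul_eq_mul]
  have hi := i.2
  have e1 : (i + 1) * (List.ofFn g).flatten.length / 6 = min (i + 1 : ℕ) 6 • n := by
    rw [hlen, min_eq_left (by omega), smul_eq_mul,
      show ((i : ℕ) + 1) * (6 * n) = 6 * ((i + 1) * n) by ring]
    omega
  have e2 : i * (List.ofFn g).flatten.length / 6 = min (i : ℕ) 6 • n := by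
    rw [hlen, min_eq_left (by omega), smul_eq_mul, show (i : ℕ) * (6 * n) = 6 * (i * n) by ring]
    omega
  rw [block, e1, e2, h]

/-! ### Independent blocks -/

/-- Fubini for one coordinate: an event whose conditional probability given the other coordinates is
at most `ε` has probability at most `ε`. -/
theorem measure_pi_le_of_update {m : ℕ} {Y : Type*} [Countable Y] [MeasurableSpace Y]
    [DiscreteMeasurableSpace Y] (P : Measure Y) [IsProbabilityMeasure P] (j : Fin (m + 1))
    {B : Set (Fin (m + 1) → Y)} {ε : ENNReal}
    (h : ∀ ω, P {b | Function.update ω j b ∈ B} ≤ ε) :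
    (Measure.pi fun _ : Fin (m + 1) => P) B ≤ ε := by
  have hmp := (measurePreserving_piFinSuccAbove (fun _ : Fin (m + 1) => P) j).symm
  rw [← hmp.measure_preimage MeasurableSet.of_discrete.nullMeasurableSet,
    Measure.prod_apply_symm .of_discrete]
  have hne : Nonempty Y := nonempty_of_isProbabilityMeasure P
  obtain ⟨y⟩ := hne
  calc _ ≤ ∫⁻ _, ε ∂(Measure.pi fun _ : Fin m => P) := by
        refine lintegral_mono fun ω => ?_
        refine le_trans (le_of_eq ?_) (h (j.insertNth y ω))
        congr 1
        ext b
        have e : (MeasurableEquiv.piFinSuccAbove (fun _ => Y) j).symm (b, ω) =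
          j.insertNth b ω := rfl
        simp only [Set.mem_preimage, Set.mem_ofPred_eq, e, Fin.update_insertNth]
    _ = ε := by simp

/-- Split a sequence of length `m * n` into `m` consecutive blocks of length `n`. -/
def splitBlocks {X : Type*} (m n : ℕ) (S : Fin (m * n) → X) : Fin m → Fin n → X :=
  fun i j => S ⟨i * n + j, by
    calc
      (i : ℕ) * n + j < (i + 1) * n := by rw [Nat.add_mul, Nat.one_mul]; omega
      _ ≤ m * n := Nat.mul_le_mul_right _ i.prop⟩

theorem measurePreserving_splitBlocks {X : Type*} [Countable X] [MeasurableSpace X]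
    [DiscreteMeasurableSpace X] (D : Measure X) [IsProbabilityMeasure D] (m n : ℕ) :
    MeasurePreserving (splitBlocks m n) (Measure.pi fun _ : Fin (m * n) => D)
      (Measure.pi fun _ : Fin m => Measure.pi fun _ : Fin n => D) := by
  have e : ∀ (S : Fin (m * n) → X) i j, splitBlocks m n S i j = S (finProdFinEquiv (i, j)) := by
    intro S i j
    simp only [splitBlocks]
    congr 1
    ext
    simp [finProdFinEquiv, mul_comm, add_comm]
  refine ⟨.of_discrete, Measure.ext_of_singleton fun ω => ?_⟩
  rw [Measure.map_apply .of_discrete .of_discrete]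
  have hpre : splitBlocks m n ⁻¹' {ω} =
      {fun l => ω (finProdFinEquiv.symm l).1 (finProdFinEquiv.symm l).2} := by
    ext S
    simp only [Set.mem_preimage, Set.mem_singleton_iff]
    constructor
    · rintro rfl
      funext l
      rw [e]
      exact congrArg S (finProdFinEquiv.apply_symm_apply l).symm
    · rintro rfl
      funext i j
      rw [e]
      simp
  rw [hpre, Measure.pi_singleton, Measure.pi_singleton, ← finProdFinEquiv.prod_comp,
    Fintype.prod_prod_type]
  simp

/-- The training sequence of the points `S`, labeled by `c`. -/
def labelSeq {X : Type*} {n : ℕ} (c : Hyp X) (S : Fin n → X) : TrainSeq X :=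
  List.ofFn fun i => (S i, c (S i))

theorem labelSeq_eq_flatten {X : Type*} (m n : ℕ) (c : Hyp X) (S : Fin (m * n) → X) :
    labelSeq c S = (List.ofFn fun i => labelSeq c (splitBlocks m n S i)).flatten := by
  rw [labelSeq, List.ofFn_mul]
  rfl

@[simp]
theorem length_labelSeq {X : Type*} {n : ℕ} (c : Hyp X) (S : Fin n → X) :
    (labelSeq c S).length = n := List.length_ofFn

theorem realizableBy_labelSeq {X : Type*} {n : ℕ} (c : Hyp X) (S : Fin n → X) :
    RealizableBy c (labelSeq c S) := by
  intro z hz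
  obtain ⟨i, rfl⟩ := List.mem_ofFn.1 hz
  rfl

/-! ### The error set of the concatenated votes -/

/-- The points where less than `3 / 4` of the votes in `F` are good. -/
def errSet {X : Type*} (c : Hyp X) (F : List (List (Hyp X))) : Set X :=
  {x | goodFrac c F x < 3 / 4}

theorem voters_flatten {X : Type*} {n : ℕ} (hn : 1 ≤ n) (erm : TrainSeq X → Hyp X)
    (r : List (List unitInterval)) (g : Fin 6 → TrainSeq X) (hg : ∀ i, (g i).length = n)
    (T : TrainSeq X) :
    voters erm (List.ofFn g).flatten T r =
      (List.ofFn fun i : Fin 5 => voters erm (g 0) (g i.succ ++ T) r).flatten := by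
  have hlen : 6 ≤ (List.ofFn g).flatten.length := by
    rw [List.length_flatten, List.map_ofFn, List.sum_ofFn]
    simp [hg]; omega
  have h0 := block_flatten g hg 0
  have hs : ∀ i : Fin 5, block (List.ofFn g).flatten (i + 1) = g i.succ := fun i => by
    simpa using block_flatten g hg i.succ
  rw [Fin.val_zero] at h0
  simp only [voters, subsample_eq_flatMap hlen, List.map_flatten, List.map_ofFn, h0, hs]
  rfl

theorem goodFrac_mem_Icc {X : Type*} (c : Hyp X) (F : List (List (Hyp X))) (x : X) :
    goodFrac c F x ∈ Set.Icc (0 : ℝ) 1 := by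
  classical
  have key : ∀ G : List (List (Hyp X)),
      0 ≤ (G.map fun f => if 3 / 4 ≤ correctFrac c f x then (1 : ℝ) else 0).sum ∧
      (G.map fun f => if 3 / 4 ≤ correctFrac c f x then (1 : ℝ) else 0).sum ≤ G.length := by
    intro G
    induction G with
    | nil => simp
    | cons f G ih =>
      simp only [List.map_cons, List.sum_cons, List.length_cons, Nat.cast_add, Nat.cast_one]
      split_ifs <;> constructor <;> linarith [ih.1, ih.2]
  exact ⟨div_nonneg (key F).1 (Nat.cast_nonneg _),
    div_le_one_of_le₀ (key F).2 (Nat.cast_nonneg _)⟩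

theorem goodFrac_flatten {X : Type*} (c : Hyp X) {m ℓ : ℕ} (F : Fin m → List (List (Hyp X)))
    (hF : ∀ i, (F i).length = ℓ) (x : X) :
    goodFrac c (List.ofFn F).flatten x = (∑ i, goodFrac c (F i) x) / m := by
  classical
  simp only [goodFrac, List.map_flatten, List.sum_flatten, List.length_flatten, List.map_ofFn,
    List.sum_ofFn, Function.comp_def, hF, Finset.sum_const, Finset.card_univ, Fintype.card_fin,
    smul_eq_mul, Nat.cast_mul]
  rw [← Finset.sum_div, div_div, mul_comm (m : ℝ)]

/-- If the average of the fractions `a i` of good votes is below `3 / 4`, then some `a i` is, and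
the other four groups have fractions `1 - a j` of bad votes with sum more than `5 / 4 - 1`. -/
theorem quarter_le_sum_pairs (a : Fin 5 → ℝ) (ha : ∀ i, a i ∈ Set.Icc (0 : ℝ) 1)
    (h : (∑ i, a i) / 5 < 3 / 4) :
    1 / 4 ≤ ∑ i, ∑ j ∈ Finset.univ.erase i, (if a i < 3 / 4 then 1 - a j else 0) := by
  have hex : ∃ i, a i < 3 / 4 := by
    by_contra hcon
    push Not at hcon
    have := Finset.sum_le_sum fun i (_ : i ∈ (Finset.univ : Finset (Fin 5))) => hcon i
    simp at this
    linarith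
  obtain ⟨i, hi⟩ := hex
  have hnn : ∀ i j, 0 ≤ if a i < 3 / 4 then 1 - a j else 0 := fun i j => by
    split_ifs
    · linarith [(ha j).2]
    · rfl
  refine le_trans ?_ (Finset.single_le_sum (f := fun i => ∑ j ∈ Finset.univ.erase i,
    (if a i < 3 / 4 then 1 - a j else 0)) (fun i _ => Finset.sum_nonneg fun j _ => hnn i j)
    (Finset.mem_univ i))
  simp only [hi, if_true]
  rw [Finset.sum_erase_eq_sub (Finset.mem_univ i), Finset.sum_sub_distrib]
  simp
  linarith [(ha i).1]

theorem integral_list_sum_indicator_le {X Z : Type*} [Countable X] [MeasurableSpace X]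
    [DiscreteMeasurableSpace X] (D : Measure X) [IsProbabilityMeasure D] (A : Z → Set X)
    {b : ℝ} (L : List Z) (h : ∀ f ∈ L, D.real (A f) ≤ b) :
    Integrable (fun x => (L.map fun f => (A f).indicator (1 : X → ℝ) x).sum) D ∧
      ∫ x, (L.map fun f => (A f).indicator (1 : X → ℝ) x).sum ∂D ≤ L.length * b := by
  induction L with
  | nil => simp
  | cons f L ih =>
    obtain ⟨ih1, ih2⟩ := ih fun g hg => h g (List.mem_cons_of_mem _ hg)
    have hi : Integrable ((A f).indicator (1 : X → ℝ)) D :=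
      (integrable_const (1 : ℝ)).indicator .of_discrete
    have hf := h f List.mem_cons_self
    simp only [List.map_cons, List.sum_cons]
    refine ⟨hi.add ih1, ?_⟩
    rw [integral_add hi ih1, integral_indicator_one .of_discrete]
    push_cast [List.length_cons]
    linarith

/-- The error set of five groups of votes of equal size, bounded through the bad points of single
votes within the error set of another group. There are `20` pairs of groups, and the constant is
`80 = 20 * 4`. -/
theorem real_errSet_flatten_le {X : Type*} [Countable X] [MeasurableSpace X]
    [DiscreteMeasurableSpace X] (D : Measure X) [IsProbabilityMeasure D] (c : Hyp X) {ℓ : ℕ}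
    (hℓ : 0 < ℓ) (F : Fin 5 → List (List (Hyp X))) (hF : ∀ i, (F i).length = ℓ) {b : ℝ}
    (h : ∀ i j, i ≠ j → ∀ f ∈ F j,
      D.real {x | x ∈ errSet c (F i) ∧ correctFrac c f x < 3 / 4} ≤ b) :
    D.real (errSet c (List.ofFn F).flatten) ≤ 80 * b := by
  classical
  have hℓ' : (0 : ℝ) < ℓ := by exact_mod_cast hℓ
  let A : Fin 5 → List (Hyp X) → Set X := fun i f =>
    {x | x ∈ errSet c (F i) ∧ correctFrac c f x < 3 / 4}
  let g : Fin 5 → Fin 5 → X → ℝ := fun i j x =>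
    ((F j).map fun f => (A i f).indicator (1 : X → ℝ) x).sum / ℓ
  have hg : ∀ i j x, (if goodFrac c (F i) x < 3 / 4 then 1 - goodFrac c (F j) x else 0) =
      g i j x := by
    intro i j x
    have key : ∀ G : List (List (Hyp X)),
        (G.map fun f => (A i f).indicator (1 : X → ℝ) x).sum =
        if goodFrac c (F i) x < 3 / 4 then G.length -
          (G.map fun f => if 3 / 4 ≤ correctFrac c f x then (1 : ℝ) else 0).sum else 0 := by
      intro G
      induction G with
      | nil => simp
      | cons f G ih =>
        simp only [List.map_cons, List.sum_cons, ih, List.length_cons, Nat.cast_add, Nat.cast_one]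
        by_cases h1 : goodFrac c (F i) x < 3 / 4
        · by_cases h2 : correctFrac c f x < 3 / 4
          · simp [A, errSet, h1, h2, not_le.2 h2]; ring
          · simp [A, errSet, h1, h2, not_lt.1 h2]; ring
        · simp [A, errSet, h1]
    simp only [g, key, hF j]
    split_ifs
    · rw [goodFrac, hF j, sub_div, div_self hℓ'.ne']
    · simp
  have hgi : ∀ i j, i ≠ j → Integrable (g i j) D ∧ ∫ x, g i j x ∂D ≤ b := by
    intro i j hij
    obtain ⟨h1, h2⟩ := integral_list_sum_indicator_le D (A i) (F j) fun f hf => h i j hij f hf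
    refine ⟨h1.div_const _, ?_⟩
    simp only [g]
    rw [integral_div, div_le_iff₀ hℓ']
    rw [hF j] at h2
    linarith
  have hpw : ∀ x, (errSet c (List.ofFn F).flatten).indicator (fun _ => (1 / 4 : ℝ)) x ≤
      ∑ i, ∑ j ∈ Finset.univ.erase i, g i j x := by
    intro x
    by_cases hx : x ∈ errSet c (List.ofFn F).flatten
    · rw [Set.indicator_of_mem hx]
      simp_rw [← hg]
      refine quarter_le_sum_pairs _ (fun i => goodFrac_mem_Icc c (F i) x) ?_
      have hx' : goodFrac c (List.ofFn F).flatten x < 3 / 4 := hx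
      rw [goodFrac_flatten c F hF] at hx'
      exact_mod_cast hx'
    · rw [Set.indicator_of_notMem hx]
      refine Finset.sum_nonneg fun i _ => Finset.sum_nonneg fun j _ => ?_
      rw [← hg]
      split_ifs
      · linarith [(goodFrac_mem_Icc c (F j) x).2]
      · rfl
  have hint : ∀ i, Integrable (fun x => ∑ j ∈ Finset.univ.erase i, g i j x) D := fun i =>
    integrable_finsetSum _ fun j hj => (hgi i j (Finset.ne_of_mem_erase hj).symm).1
  have hmono := integral_mono (μ := D) ((integrable_const (1 / 4 : ℝ)).indicator .of_discrete)
    (integrable_finsetSum _ fun i _ => hint i) hpw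
  rw [integral_indicator .of_discrete, setIntegral_const,
    integral_finsetSum _ fun i _ => hint i] at hmono
  have hsum : ∑ i, ∫ x, ∑ j ∈ Finset.univ.erase i, g i j x ∂D ≤ ∑ _i : Fin 5, 4 * b := by
    refine Finset.sum_le_sum fun i _ => ?_
    rw [integral_finsetSum _ fun j hj => (hgi i j (Finset.ne_of_mem_erase hj).symm).1]
    calc _ ≤ ∑ j ∈ Finset.univ.erase i, b :=
          Finset.sum_le_sum fun j hj => (hgi i j (Finset.ne_of_mem_erase hj).symm).2
      _ = 4 * b := by
          rw [Finset.sum_const, Finset.card_erase_of_mem (Finset.mem_univ i)]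
          simp
  rw [Finset.sum_const, Finset.card_univ, Fintype.card_fin, nsmul_eq_mul] at hsum
  rw [smul_eq_mul] at hmono
  push_cast at hsum
  linarith

/-! ### The recursion -/

/-- A vote obtained from `S` and `T` is correct with margin on the whole of `T`. -/
theorem voter_spec {X : Type*} {H : Set (Hyp X)} {erm : TrainSeq X → Hyp X}
    (herm : IsERM H erm) {c : Hyp X} (hc : c ∈ H) (r : List (List unitInterval))
    {S T : TrainSeq X} (hS : RealizableBy c S) (hT : RealizableBy c T) (hS0 : S ≠ [])
    (hT0 : T ≠ []) {f : List (Hyp X)} (hf : f ∈ voters erm S T r) :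
    f ≠ [] ∧ (∀ h ∈ f, h ∈ H) ∧ ∀ z ∈ T, 7 / 8 ≤ correctFrac c f z.1 := by
  obtain ⟨S', hS', rfl⟩ := List.mem_map.1 hf
  obtain ⟨h1, h2, h3⟩ := mem_subsample_spec hS0 hS'
  have hlen : 2 ≤ S'.length := by
    have := List.length_pos_iff.2 hT0
    omega
  obtain ⟨h4, h5, h6⟩ := adaBoostSample_spec herm hc
    (fun z hz => (h2 z hz).elim (hS z) (hT z)) hlen r
  exact ⟨h4, h5, fun z hz => h6 z (h1 z hz)⟩

theorem realizableBy_append {X : Type*} {c : Hyp X} {S T : TrainSeq X} (hS : RealizableBy c S)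
    (hT : RealizableBy c T) : RealizableBy c (S ++ T) := fun z hz =>
  (List.mem_append.1 hz).elim (hS z) (hT z)

/-- For samples of size `n` and every initial sequence `T`, the error bound with constant `C` fails
with probability at most `δ`. -/
def ErrBound {X : Type*} [MeasurableSpace X] (D : Measure X) (c : Hyp X)
    (erm : TrainSeq X → Hyp X) (r : List (List unitInterval)) (d : ℕ) (C : ℝ) (n : ℕ) : Prop :=
  ∀ (T : TrainSeq X) (δ : ℝ), RealizableBy c T → 0 < δ → δ < 1 →
    (Measure.pi fun _ : Fin n => D)
      {S | C * ((d + Real.log (1 / δ)) / n) < D.real (errSet c (voters erm (labelSeq c S) T r))} ≤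
      ENNReal.ofReal δ

theorem add_log_div_hundred_le {d : ℕ} (hd : 1 ≤ d) {δ : ℝ} (hδ : 0 < δ) (hδ1 : δ < 1) :
    d + Real.log (1 / (δ / 100)) ≤ 6 * (d + Real.log (1 / δ)) := by
  have h1 : Real.log (1 / (δ / 100)) = Real.log (1 / δ) + Real.log 100 := by
    rw [← Real.log_mul (by positivity) (by norm_num)]
    congr 1
    field_simp
  have h2 : Real.log 100 ≤ 5 := by
    have h3 : Real.log 100 ≤ Real.log (2 ^ 7) := Real.log_le_log (by norm_num) (by norm_num)
    rw [Real.log_pow] at h3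
    push_cast at h3
    linarith [Real.log_two_lt_d9]
  have h4 : 0 ≤ Real.log (1 / δ) := Real.log_nonneg (by rw [le_div_iff₀ hδ]; linarith)
  have h5 : (1 : ℝ) ≤ d := by exact_mod_cast hd
  linarith

/-- Combination of the bounds for one pair of groups. Here `p` is the probability of the error set
of the first group, and `β` that of the bad points of a vote of the second group within it. The
margin bound applies unless `p` is small, in which case `β ≤ p` is good enough. -/
theorem real_region_le {p β K C L L' n : ℝ} (hn : 0 < n) (hp : p ≤ C * (L' / n))
    (hL : L' ≤ 6 * L) (hK : 0 ≤ K) (hC : 2880 * K = C) (hβp : β ≤ p)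
    (hβ : K * L' ≤ n * p → β ≤ 1 / 2880 * p) : 80 * β ≤ C * (L / (6 * n)) := by
  have e : C * (L / (6 * n)) = 480 * (K * L) / n := by
    rw [← hC]; field_simp; ring
  have hle : K * L' ≤ 6 * (K * L) := by nlinarith
  suffices h : β ≤ K * L' / n by
    have : 80 * (K * L' / n) ≤ 480 * (K * L) / n := by
      rw [← mul_div_assoc]
      exact (div_le_div_iff_of_pos_right hn).2 (by linarith)
    linarith
  rcases le_or_gt (K * L') (n * p) with h | h
  · calc β ≤ 1 / 2880 * p := hβ h
      _ ≤ 1 / 2880 * (C * (L' / n)) := by gcongr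
      _ = K * L' / n := by rw [← hC]; ring
  · rw [le_div_iff₀ hn]
    nlinarith

/-- The inductive step. The error bounds of the five recursive calls and the margin bounds of the
pairs of calls are used with `δ / 100`, which leaves room for all of these events. -/
theorem ErrBound.step {X : Type*} [Countable X] [MeasurableSpace X]
    [DiscreteMeasurableSpace X] (D : Measure X) [IsProbabilityMeasure D] {H : Set (Hyp X)}
    {erm : TrainSeq X → Hyp X} (herm : IsERM H erm) {c : Hyp X} (hc : c ∈ H)
    (r : List (List unitInterval)) {d : ℕ} (hd1 : 1 ≤ d) {K : ℝ} (hK : 0 ≤ K)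
    (hmargin : ∀ (R : Set X) (n : ℕ) (δ : ℝ), 0 < δ → δ < 1 →
      K * (d + Real.log (1 / δ)) ≤ n * D.real R →
      (Measure.pi fun _ : Fin n => D)
        {S | ∃ f : List (Hyp X), f ≠ [] ∧ (∀ h ∈ f, h ∈ H) ∧
          (∀ i, S i ∈ R → 7 / 8 ≤ correctFrac c f (S i)) ∧
          1 / 2880 * D.real R < D.real {x | x ∈ R ∧ correctFrac c f x < 3 / 4}} ≤
        ENNReal.ofReal (2 * δ))
    {n : ℕ} (hn : 1 ≤ n) (ih : ErrBound D c erm r d (2880 * K) n) :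
    ErrBound D c erm r d (2880 * K) (6 * n) := by
  intro T δ hT hδ hδ1
  have hn0 : (0 : ℝ) < n := by exact_mod_cast hn
  set δ' := δ / 100 with hδ'
  have hδ'0 : 0 < δ' := by positivity
  have hδ'1 : δ' < 1 := by rw [hδ']; linarith
  set L' := d + Real.log (1 / δ') with hL'
  -- the voters of the `i`-th recursive call
  let V : (Fin 6 → Fin n → X) → Fin 5 → List (List (Hyp X)) := fun ω i =>
    voters erm (labelSeq c (ω 0)) (labelSeq c (ω i.succ) ++ T) r
  let ν : Measure (Fin 6 → Fin n → X) := Measure.pi fun _ => Measure.pi fun _ => D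
  let A : Fin 5 → Set (Fin 6 → Fin n → X) := fun i =>
    {ω | 2880 * K * (L' / n) < D.real (errSet c (V ω i))}
  let B : Fin 5 × Fin 5 → Set (Fin 6 → Fin n → X) := fun s =>
    {ω | s.1 ≠ s.2 ∧ K * L' ≤ n * D.real (errSet c (V ω s.1)) ∧
      ∃ f : List (Hyp X), f ≠ [] ∧ (∀ h ∈ f, h ∈ H) ∧
        (∀ l, ω s.2.succ l ∈ errSet c (V ω s.1) → 7 / 8 ≤ correctFrac c f (ω s.2.succ l)) ∧
        1 / 2880 * D.real (errSet c (V ω s.1)) <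
          D.real {x | x ∈ errSet c (V ω s.1) ∧ correctFrac c f x < 3 / 4}}
  have hA : ∀ i, ν (A i) ≤ ENNReal.ofReal δ' := by
    intro i
    -- given the block `i + 1`, the induction hypothesis applies to block `0`
    refine measure_pi_le_of_update _ 0 fun ω => ?_
    refine le_trans (le_of_eq ?_) (ih (labelSeq c (ω i.succ) ++ T) δ'
      (realizableBy_append (realizableBy_labelSeq c _) hT) hδ'0 hδ'1)
    simp [A, V, hL']
  have hB : ∀ s, ν (B s) ≤ ENNReal.ofReal (2 * δ') := by
    rintro ⟨i, j⟩
    -- given the other blocks, the region is fixed and block `j + 1` is a fresh sample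
    refine measure_pi_le_of_update _ j.succ fun ω => ?_
    by_cases hij : i = j
    · simp [B, hij]
    have hV : ∀ b, V (Function.update ω j.succ b) i = V ω i := by
      intro b
      simp only [V]
      rw [Function.update_of_ne (Fin.succ_ne_zero j).symm,
        Function.update_of_ne (fun h => hij (Fin.succ_injective _ h))]
    by_cases hp : K * L' ≤ n * D.real (errSet c (V ω i))
    · refine (measure_mono ?_).trans (hmargin (errSet c (V ω i)) n δ' hδ'0 hδ'1 hp)
      rintro b ⟨-, -, h⟩
      simp only [hV, Function.update_self] at h
      exact h
    · simp [B, hV, hp]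
  have hsub : {ω : Fin 6 → Fin n → X | 2880 * K * ((d + Real.log (1 / δ)) / (6 * n)) <
      D.real (errSet c (List.ofFn (V ω)).flatten)} ⊆ (⋃ i, A i) ∪ ⋃ s, B s := by
    intro ω hω
    by_contra hcon
    simp only [Set.mem_union, Set.mem_iUnion, not_or, not_exists] at hcon
    obtain ⟨hnA, hnB⟩ := hcon
    rw [Set.mem_ofPred_eq] at hω
    refine absurd hω (not_lt.2 ?_)
    have hne : ∀ i, labelSeq c (ω i) ≠ [] := fun i => by
      rw [← List.length_pos_iff, length_labelSeq]; exact hn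
    have hlen : ∀ i, (V ω i).length = (V ω 0).length ∧ 0 < (V ω i).length := fun i => by
      simp only [V, voters, List.length_map]
      exact length_subsample _ _ _
    have := real_errSet_flatten_le D c (hlen 0).2 (V ω) (fun i => (hlen i).1)
      (b := 2880 * K * ((d + Real.log (1 / δ)) / (6 * n)) / 80) ?_
    · linarith
    intro i j hij f hf
    obtain ⟨h1, h2, h3⟩ := voter_spec herm hc r (realizableBy_labelSeq c (ω 0))
      (realizableBy_append (realizableBy_labelSeq c (ω j.succ)) hT) (hne 0)
      (List.append_ne_nil_of_left_ne_nil (hne j.succ) T) hf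
    rw [le_div_iff₀ (by norm_num), mul_comm]
    refine real_region_le hn0 (not_lt.1 (hnA i)) (add_log_div_hundred_le hd1 hδ hδ1) hK rfl
      (measureReal_mono fun x hx => hx.1) fun hp => ?_
    by_contra hlt
    refine hnB (i, j) ⟨hij, hp, f, h1, h2, fun l _ => ?_, not_le.1 hlt⟩
    exact h3 (ω j.succ l, c (ω j.succ l))
      (List.mem_append_left _ (List.mem_ofFn.2 ⟨l, rfl⟩))
  have hpre : {S : Fin (6 * n) → X | 2880 * K * ((d + Real.log (1 / δ)) / (6 * n : ℕ)) <
      D.real (errSet c (voters erm (labelSeq c S) T r))} = splitBlocks 6 n ⁻¹'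
      {ω | 2880 * K * ((d + Real.log (1 / δ)) / (6 * n)) <
        D.real (errSet c (List.ofFn (V ω)).flatten)} := by
    ext S
    simp only [Set.mem_preimage, Set.mem_ofPred_eq, V]
    rw [labelSeq_eq_flatten 6 n, voters_flatten hn erm r _ (fun i => length_labelSeq c _) T]
    push_cast
    rfl
  rw [hpre, (measurePreserving_splitBlocks D 6 n).measure_preimage
    MeasurableSet.of_discrete.nullMeasurableSet]
  calc _ ≤ ν ((⋃ i, A i) ∪ ⋃ s, B s) := measure_mono hsub
    _ ≤ ∑ i, ν (A i) + ∑ s, ν (B s) := (measure_union_le _ _).trans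
        (add_le_add (measure_iUnion_fintype_le _ _) (measure_iUnion_fintype_le _ _))
    _ ≤ ∑ _i : Fin 5, ENNReal.ofReal δ' + ∑ _s : Fin 5 × Fin 5, ENNReal.ofReal (2 * δ') :=
        add_le_add (Finset.sum_le_sum fun i _ => hA i) (Finset.sum_le_sum fun s _ => hB s)
    _ = ENNReal.ofReal (55 * δ') := by
        rw [← ENNReal.ofReal_sum_of_nonneg fun _ _ => hδ'0.le,
          ← ENNReal.ofReal_sum_of_nonneg fun _ _ => by positivity,
          ← ENNReal.ofReal_add (by positivity) (by positivity)]
        congr 1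
        simp
        ring
    _ ≤ ENNReal.ofReal δ := ENNReal.ofReal_le_ofReal (by rw [hδ']; linarith)

theorem errBound_pow {X : Type*} [Countable X] [MeasurableSpace X]
    [DiscreteMeasurableSpace X] (D : Measure X) [IsProbabilityMeasure D] {H : Set (Hyp X)}
    {erm : TrainSeq X → Hyp X} (herm : IsERM H erm) {c : Hyp X} (hc : c ∈ H)
    (r : List (List unitInterval)) {d : ℕ} (hd1 : 1 ≤ d) {K : ℝ} (hK : 1 ≤ K)
    (hmargin : ∀ (R : Set X) (n : ℕ) (δ : ℝ), 0 < δ → δ < 1 →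
      K * (d + Real.log (1 / δ)) ≤ n * D.real R →
      (Measure.pi fun _ : Fin n => D)
        {S | ∃ f : List (Hyp X), f ≠ [] ∧ (∀ h ∈ f, h ∈ H) ∧
          (∀ i, S i ∈ R → 7 / 8 ≤ correctFrac c f (S i)) ∧
          1 / 2880 * D.real R < D.real {x | x ∈ R ∧ correctFrac c f x < 3 / 4}} ≤
        ENNReal.ofReal (2 * δ)) (k : ℕ) :
    ErrBound D c erm r d (2880 * K) (6 ^ k) := by
  induction k with
  | zero =>
    intro T δ _ hδ hδ1
    have h4 : 0 ≤ Real.log (1 / δ) := Real.log_nonneg (by rw [le_div_iff₀ hδ]; linarith)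
    have h5 : (1 : ℝ) ≤ d := by exact_mod_cast hd1
    -- for a sample of size `1` the bound exceeds `1`, because `1 ≤ d`
    refine (measure_mono_null (fun S hS => ?_) measure_empty).le.trans zero_le
    refine absurd hS (not_lt.2 (measureReal_le_one.trans ?_))
    simp only [pow_zero, Nat.cast_one, div_one]
    nlinarith
  | succ k ih =>
    rw [pow_succ']
    exact ErrBound.step D herm hc r hd1 (by linarith) hmargin (Nat.one_le_pow _ _ (by norm_num)) ih

/-! ### VC-dimension zero -/

/-- A class of VC-dimension `0` has at most one member. -/
theorem HasVCDim.subsingleton {X : Type*} {H : Set (Hyp X)} (h : HasVCDim H 0) :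
    H.Subsingleton := by
  intro f hf g hg
  by_contra hne
  obtain ⟨x, hx⟩ := Function.ne_iff.1 hne
  have h1 : ∃ x : Fin 1 → X, ∀ y : Fin 1 → Label, ∃ h ∈ H, ∀ i, h (x i) = y i := ?_
  · exact absurd (h.2 h1) (by norm_num)
  refine ⟨fun _ => x, fun y => ?_⟩
  by_cases h1 : f x = y 0
  · exact ⟨f, hf, fun i => by rw [Subsingleton.elim i 0, h1]⟩
  · refine ⟨g, hg, fun i => ?_⟩
    rw [Subsingleton.elim i 0]
    rcases Int.units_eq_one_or (f x) with h2 | h2 <;>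
      rcases Int.units_eq_one_or (g x) with h3 | h3 <;>
      rcases Int.units_eq_one_or (y 0) with h4 | h4 <;> simp_all

theorem errSet_eq_empty {X : Type*} {c : Hyp X} {F : List (List (Hyp X))} (hF : F ≠ [])
    (h : ∀ f ∈ F, f ≠ [] ∧ ∀ g ∈ f, g = c) : errSet c F = ∅ := by
  classical
  refine Set.eq_empty_of_forall_notMem fun x hx => ?_
  have hx' : goodFrac c F x < 3 / 4 := hx
  refine absurd hx' (not_lt.2 ?_)
  have h1 : ∀ f ∈ F, correctFrac c f x = 1 := by
    intro f hf
    obtain ⟨hne, hfc⟩ := h f hf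
    have hl : (f.length : ℝ) ≠ 0 := by simpa using hne
    rw [correctFrac, List.map_congr_left (g := fun _ => (1 : ℝ))
      (fun g hg => by rw [hfc g hg, if_pos rfl])]
    simp [hl]
  have hl : (F.length : ℝ) ≠ 0 := by simpa using hF
  rw [goodFrac, List.map_congr_left (g := fun _ => (1 : ℝ))
    (fun f hf => by rw [h1 f hf, if_pos (by norm_num)])]
  simp [hl]
  norm_num

/-- The case of VC-dimension `0`, where the claimed bound can be arbitrarily close to `0` and so the
trivial bound for the start of the induction is not available. -/
theorem errSet_eq_empty_of_subsingleton {X : Type*} {H : Set (Hyp X)} (hH : H.Subsingleton)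
    {erm : TrainSeq X → Hyp X} (herm : IsERM H erm) {c : Hyp X} (hc : c ∈ H)
    (r : List (List unitInterval)) {S T : TrainSeq X} (hS : RealizableBy c S)
    (hT : RealizableBy c T) (hlen : 6 ≤ S.length) : errSet c (voters erm S T r) = ∅ := by
  refine errSet_eq_empty ?_ fun f hf => ?_
  · rw [← List.length_pos_iff, voters, List.length_map]
    exact (length_subsample S T T).2
  · obtain ⟨S', hS', rfl⟩ := List.mem_map.1 hf
    rw [subsample_eq_flatMap hlen] at hS'
    obtain ⟨l, hl, hS'⟩ := List.mem_flatten.1 hS'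
    obtain ⟨i, rfl⟩ := List.mem_ofFn.1 hl
    have hblock : ∀ j, RealizableBy c (block S j) := fun j z hz => hS z (mem_of_mem_block hz)
    have hne : block S (i + 1) ≠ [] := by
      have := i.2
      rw [← List.length_pos_iff]
      simp only [block, List.length_drop, List.length_take]
      rw [show ((i : ℕ) + 1 + 1) * S.length = (i + 1) * S.length + S.length by ring]
      have : ((i : ℕ) + 1) * S.length ≤ 5 * S.length := Nat.mul_le_mul_right _ (by omega)
      omega
    obtain ⟨h1, h2, -⟩ := voter_spec herm hc r (hblock 0)
      (realizableBy_append (hblock (i + 1)) hT) (block_zero_ne_nil hlen)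
      (List.append_ne_nil_of_left_ne_nil hne T) (List.mem_map.2 ⟨S', hS', rfl⟩)
    exact ⟨h1, fun g hg => hH (h2 g hg) hc⟩

end OptPAC

end


theorem mainTheorem2 :
    ∃ C : ℝ, ∀ (X : Type*) [Countable X] [MeasurableSpace X] [DiscreteMeasurableSpace X]
      (D : MeasureTheory.Measure X) [MeasureTheory.IsProbabilityMeasure D]
      (H : Set (OptPAC.Hyp X)) (d : ℕ) (erm : OptPAC.TrainSeq X → OptPAC.Hyp X)
      (c : OptPAC.Hyp X) (δ : ℝ) (k : ℕ) (T : OptPAC.TrainSeq X)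
      (r : List (List unitInterval)),
      H.Countable → OptPAC.HasVCDim H d → OptPAC.IsERM H erm → c ∈ H →
      0 < δ → δ < 1 → 1 ≤ k → OptPAC.RealizableBy c T →
      1 - δ ≤
        (MeasureTheory.Measure.pi (fun _ : Fin (6 ^ k) => OptPAC.labeled D c)).real
          {S : Fin (6 ^ k) → X × OptPAC.Label |
            D.real {x : X | OptPAC.goodFrac c (OptPAC.voters erm (List.ofFn S) T r) x < 3 / 4}
              ≤ C * ((d + Real.log (1 / δ)) / (6 : ℝ) ^ k)} := by
  open OptPAC in
  obtain ⟨K, hK1, hK⟩ := margin_generalization (η := 1 / 2880) (by norm_num) (by norm_num)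
  refine ⟨2880 * K, ?_⟩
  intro X _ _ _ D _ H d erm c δ k T r _ hd herm hc hδ hδ1 hk hT
  have hbad : (Measure.pi fun _ : Fin (6 ^ k) => D)
      {S | 2880 * K * ((d + Real.log (1 / δ)) / (6 ^ k : ℕ)) <
        D.real (errSet c (voters erm (labelSeq c S) T r))} ≤ ENNReal.ofReal δ := by
    rcases Nat.eq_zero_or_pos d with rfl | hd1
    · have hl : 0 ≤ Real.log (1 / δ) := Real.log_nonneg (by rw [le_div_iff₀ hδ]; linarith)
      refine (measure_mono_null (fun S hS => ?_) measure_empty).le.trans zero_le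
      rw [Set.mem_ofPred_eq] at hS
      refine absurd hS (not_lt.2 ?_)
      rw [errSet_eq_empty_of_subsingleton hd.subsingleton herm hc r (realizableBy_labelSeq c S) hT]
      · rw [measureReal_empty]
        positivity
      · rw [length_labelSeq]
        calc 6 = 6 ^ 1 := rfl
          _ ≤ 6 ^ k := Nat.pow_le_pow_right (by norm_num) hk
    · exact errBound_pow D herm hc r hd1 hK1 (hK D hd c) k T δ hT hδ hδ1
  have hmap : Measure.pi (fun _ : Fin (6 ^ k) => labeled D c) =
      (Measure.pi fun _ : Fin (6 ^ k) => D).map fun S i => (S i, c (S i)) := by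
    have : ∀ _ : Fin (6 ^ k), SigmaFinite (D.map fun x => (x, c x)) := fun _ => by
      have := Measure.isProbabilityMeasure_map (μ := D) (f := fun x => (x, c x))
        Measurable.of_discrete.aemeasurable
      infer_instance
    exact (Measure.pi_map_pi (μ := fun _ : Fin (6 ^ k) => D) (f := fun _ x => (x, c x))
      fun _ => Measurable.of_discrete.aemeasurable).symm
  rw [hmap, map_measureReal_apply .of_discrete .of_discrete]
  have hcompl : ((fun (S : Fin (6 ^ k) → X) i => (S i, c (S i))) ⁻¹'
      {S | D.real {x : X | goodFrac c (voters erm (List.ofFn S) T r) x < 3 / 4} ≤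
        2880 * K * ((d + Real.log (1 / δ)) / (6 : ℝ) ^ k)}) =
      {S | 2880 * K * ((d + Real.log (1 / δ)) / (6 ^ k : ℕ)) <
        D.real (errSet c (voters erm (labelSeq c S) T r))}ᶜ := by
    ext S
    simp [errSet, labelSeq]
  rw [hcompl, probReal_compl_eq_one_sub .of_discrete]
  have : (Measure.pi fun _ : Fin (6 ^ k) => D).real
      {S | 2880 * K * ((d + Real.log (1 / δ)) / (6 ^ k : ℕ)) <
        D.real (errSet c (voters erm (labelSeq c S) T r))} ≤ δ :=
    ENNReal.toReal_le_of_le_ofReal hδ.le hbad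
  linarith
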